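/- Let $\ell$ be a prime and let $F$ be a global function field of characteristic $\ell$, i.e. a finite extension of $\mathbb{F}_\ell(t)$ for some $t\in F$ transcendental over $\mathbb{F}_\ell$. Let $\kappa$ be the algebraic closure of $\mathbb{F}_\ell$ in $F$. A prime of $F$ is the maximal ideal of a discrete valuation ring $R\subset F$ with fraction field $F$; its degree is the dimension over $\kappa$ of the residue field of $R$. Assume that $F$ has a prime $P_\infty$ of degree $1$, and let $\mathcal{O}_F$ be the ring of functions in $F$ with no poles outside $\{P_\infty\}$. For a global function field $K$, let $h_K$ be its class number, i.e. the order of the group of divisor classes of degree $0$ of $K$ (degrees being taken over the field of constants of $K$), and let $F(\mu_n)$ denote the field obtained by adjoining the $n$-th roots of unity to $F$. Let $p$ and $q$ be prime numbers such that 1. $p\neq\ell$ and $q\neq\ell$; 2. if $p\neq q$, then $q\nmid h_{F(\mu_p)}$ or $p\nmid h_{F(\mu_q)}$; 3. if $q=2$, $p\neq 2$ and $q\mid h_{F(\mu_p)}$, then $p\nmid h_{F(\mu_4)}$. Then every solution $(X,Y)\in\mathcal{O}_F^2$ of $X^p-Y^q=1$ is constant, i.e. satisfies $X,Y\in\kappa$.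 More generally, if $m>1$ and $n>1$ are integers such that $m$ is divisible by a prime $p$ and $n$ by a prime $q$ for which conditions 1–3 hold, then every solution $(X,Y)\in\mathcal{O}_F^2$ of $X^m-Y^n=1$ is constant. -/

import Mathlib

open scoped IntermediateField

noncomputable section

namespace GlobalFF

universe u

/-- `F` is a global function field of characteristic `ℓ`: it contains an element `t` which is
transcendental over `𝔽_ℓ` and such that `F` is a finite extension of `𝔽_ℓ(t)`. -/
def IsGlobalFunctionField (ℓ : ℕ) [Fact ℓ.Prime] (F : Type u) [Field F] [Algebra (ZMod ℓ) F] :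
    Prop :=
  ∃ t : F, Transcendental (ZMod ℓ) t ∧ FiniteDimensional ↥(ZMod ℓ)⟮t⟯ F

/-- The field of constants `κ` of `F`: the algebraic closure of `𝔽_ℓ` in `F`. -/
abbrev constants (ℓ : ℕ) [Fact ℓ.Prime] (F : Type u) [Field F] [Algebra (ZMod ℓ) F] :
    IntermediateField (ZMod ℓ) F :=
  algebraicClosure (ZMod ℓ) F

/-- A prime of `F`, given by its discrete valuation ring, a subring of `F` with fraction
field `F`. -/
structure Place (F : Type u) [Field F] where
  /-- The valuation ring of the prime. -/
  ring : ValuationSubring F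
  /-- The valuation ring is a discrete valuation ring. -/
  isDVR : IsDiscreteValuationRing ring

namespace Place

variable {F : Type u} [Field F]

instance (v : Place F) : IsDiscreteValuationRing v.ring := v.isDVR

/-- The order `ord_v(g)` of a nonzero function `g` at the prime `v`: the multiplicative
`v`-adic valuation of `g` is `exp (-ord_v(g))`. (The value at `g = 0` is never used.) -/
def ord (v : Place F) (g : F) : ℤ :=
  -WithZero.log ((IsDiscreteValuationRing.maximalIdeal v.ring).valuation F g)

/-- The constants lie in every valuation ring of `F`. -/
theorem constants_mem (ℓ : ℕ) [Fact ℓ.Prime] [Algebra (ZMod ℓ) F] (v : Place F)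
    (c : constants ℓ F) : (c : F) ∈ v.ring := by
  have hc : IsIntegral (ZMod ℓ) (c : F) := (mem_algebraicClosure_iff.mp c.2).isIntegral
  obtain ⟨f, hf, hfc⟩ := hc
  have hr : ∀ a : ZMod ℓ, algebraMap (ZMod ℓ) F a ∈ v.ring := by
    intro a
    obtain ⟨n, rfl⟩ := ZMod.natCast_zmod_surjective a
    rw [map_natCast]
    exact natCast_mem v.ring n
  let φ : ZMod ℓ →+* v.ring := (algebraMap (ZMod ℓ) F).codRestrict v.ring hr
  have hi : IsIntegral v.ring (c : F) := by
    refine ⟨f.map φ, hf.map φ, ?_⟩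
    rw [Polynomial.eval₂_map]
    exact hfc
  obtain ⟨y, hy⟩ := IsIntegrallyClosed.isIntegral_iff.mp hi
  rw [← hy]
  exact y.2

/-- The inclusion of the field of constants in the valuation ring of a prime. -/
instance constantsAlgebra (ℓ : ℕ) [Fact ℓ.Prime] [Algebra (ZMod ℓ) F] (v : Place F) :
    Algebra (constants ℓ F) v.ring :=
  ((algebraMap (constants ℓ F) F).codRestrict v.ring (constants_mem ℓ v)).toAlgebra

/-- The degree of a prime: the dimension of its residue field over the field of constants. -/
def degree (ℓ : ℕ) [Fact ℓ.Prime] [Algebra (ZMod ℓ) F] (v : Place F) : ℕ :=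
  Module.finrank (constants ℓ F) (IsLocalRing.ResidueField v.ring)

end Place

/-- The ring `𝒪_F` of functions in `F` with no poles outside `P`. -/
def integers {F : Type u} [Field F] (P : Place F) : Subring F :=
  ⨅ v : {v : Place F // v ≠ P}, v.1.ring.toSubring

/-- The group of divisors: finite integral linear combinations of primes of `F`. -/
abbrev Divisor (F : Type u) [Field F] : Type u := Place F →₀ ℤ

/-- The degree of a divisor. -/
def degHom (ℓ : ℕ) [Fact ℓ.Prime] (F : Type u) [Field F] [Algebra (ZMod ℓ) F] :
    Divisor F →+ ℤ :=
  Finsupp.liftAddHom fun v => (AddMonoidHom.mulRight (v.degree ℓ : ℤ))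

theorem ord_one {F : Type u} [Field F] (v : Place F) : v.ord 1 = 0 := by
  simp [Place.ord]

theorem ord_mul {F : Type u} [Field F] (v : Place F) {f g : F} (hf : f ≠ 0) (hg : g ≠ 0) :
    v.ord (f * g) = v.ord f + v.ord g := by
  simp only [Place.ord, map_mul]
  rw [WithZero.log_mul (by simpa using hf) (by simpa using hg), neg_add]

theorem ord_inv {F : Type u} [Field F] (v : Place F) (f : F) :
    v.ord f⁻¹ = -v.ord f := by
  simp only [Place.ord, map_inv₀, WithZero.log_inv]

/-- The subgroup of principal divisors `div(g) = ∑ ord_v(g) v`, with `g` a nonzero function. -/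
def principal (F : Type u) [Field F] : AddSubgroup (Divisor F) where
  carrier := {D | ∃ g : F, g ≠ 0 ∧ ∀ v, D v = v.ord g}
  zero_mem' := ⟨1, one_ne_zero, fun v => (ord_one v).symm⟩
  add_mem' := by
    rintro D E ⟨f, hf, hD⟩ ⟨g, hg, hE⟩
    exact ⟨f * g, mul_ne_zero hf hg, fun v => by
      rw [Finsupp.add_apply, hD, hE, ord_mul v hf hg]⟩
  neg_mem' := by
    rintro D ⟨f, hf, hD⟩
    exact ⟨f⁻¹, inv_ne_zero hf, fun v => by rw [Finsupp.neg_apply, hD, ord_inv]⟩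

/-- The group of divisor classes of degree zero. -/
abbrev ClassGroupZero (ℓ : ℕ) [Fact ℓ.Prime] (F : Type u) [Field F] [Algebra (ZMod ℓ) F] :
    Type u :=
  (degHom ℓ F).ker ⧸ (principal F).addSubgroupOf (degHom ℓ F).ker

/-- The class number `h_F`: the order of the group of divisor classes of degree zero. -/
def classNumber (ℓ : ℕ) [Fact ℓ.Prime] (F : Type u) [Field F] [Algebra (ZMod ℓ) F] : ℕ :=
  Nat.card (ClassGroupZero ℓ F)

/-- The conditions on a pair of primes `(p, q)`; here `CyclotomicField n F` is the field
`F(μ_n)` obtained by adjoining the `n`-th roots of unity to `F`. -/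
structure Admissible (ℓ : ℕ) [Fact ℓ.Prime] (F : Type u) [Field F] [Algebra (ZMod ℓ) F]
    (p q : ℕ) : Prop where
  prime_left : p.Prime
  prime_right : q.Prime
  ne_char_left : p ≠ ℓ
  ne_char_right : q ≠ ℓ
  class_cond : p ≠ q → ¬ q ∣ classNumber ℓ (CyclotomicField p F) ∨
    ¬ p ∣ classNumber ℓ (CyclotomicField q F)
  two_cond : q = 2 → p ≠ 2 → q ∣ classNumber ℓ (CyclotomicField p F) →
    ¬ p ∣ classNumber ℓ (CyclotomicField 4 F)

end GlobalFF

end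

/-! Suppose first that `q` does not divide the class number of `L = F(μ_p)`. Since `L` is generated
by a constant, the prime of degree one extends uniquely to `L`, again with degree one. Over `L` the
polynomial `X ^ p - 1 = Y ^ q` splits into factors `X - c` without common zeros, as `p` is
invertible. Hence away from infinity every order of `X - c` is a multiple of `q`. The order at
infinity is one as well, because the divisor has degree zero and the infinite prime has degree one.
So the divisor is `q • E` with `E` of degree zero, `E` is principal because `q ∤ h_L`, and `X - c =
u * z ^ q` with `u` constant.

Two distinct roots `c` give `u₁ * z₁ ^ q - u₂ * z₂ ^ q` equal to a nonzero constant. If `z₁` is not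
constant, comparison of leading terms at infinity shows that `u₁ / u₂` is a `q`-th power of a
constant. This leaves a difference of two `q`-th powers that is a nonzero constant. Both of its
factors have poles at infinity only, so both are constant, and comparison of orders at infinity then
forces the two functions to be constant.

In the remaining case the same argument applies to `Y ^ q + 1 = X ^ p` with the roles of `p` and `q`
exchanged, over `F(μ_q)`, or over `F(μ_4)` when `q = 2`. If `p = q` the last step alone suffices.

The supporting facts are that a function without poles is constant (`mem_constants_of_forall_mem`),
that divisors of nonconstant functions with one pole of degree one have degree zero
(`exists_divisor`), and that degree-one primes extend (`exists_place_of_powerBasis`). The second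
comes from `nonempty_basis`: such a ring of functions is free over polynomials in `g`, of rank the
pole order of `g`. -/

namespace GlobalFF

open IsDedekindDomain WithZero

/-! ### Orders and valuations at a prime -/

namespace Place

variable {L : Type*} [Field L] (v : Place L)

/-- The normalized multiplicative valuation attached to a prime. -/
noncomputable def val : Valuation L (WithZero (Multiplicative ℤ)) :=
  (IsDiscreteValuationRing.maximalIdeal v.ring).valuation L

theorem val_le_one_iff {x : L} : v.val x ≤ 1 ↔ x ∈ v.ring := by
  constructor
  · intro h
    obtain ⟨a, ha⟩ := IsDiscreteValuationRing.exists_lift_of_le_one (A := v.ring) (K := L) h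
    rw [← ha]; exact a.2
  · intro h
    exact (IsDiscreteValuationRing.maximalIdeal v.ring).valuation_le_one (K := L) ⟨x, h⟩

theorem val_eq_exp {x : L} (hx : x ≠ 0) : v.val x = exp (-v.ord x) := by
  have : v.val x ≠ 0 := by simpa using hx
  rw [Place.ord, neg_neg, ← val, exp_log this]

theorem ord_nonneg_iff {x : L} (hx : x ≠ 0) : 0 ≤ v.ord x ↔ x ∈ v.ring := by
  rw [← val_le_one_iff, val_eq_exp v hx, ← exp_zero, exp_le_exp]; simp

theorem ord_nonneg {x : L} (hx : x ∈ v.ring) : 0 ≤ v.ord x := by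
  by_cases h : x = 0
  · simp [h, Place.ord]
  · exact (v.ord_nonneg_iff h).2 hx

theorem ord_pow {x : L} (n : ℕ) : v.ord (x ^ n) = n * v.ord x := by
  simp [Place.ord, map_pow, WithZero.log_pow]

theorem ord_div {x y : L} (hx : x ≠ 0) (hy : y ≠ 0) : v.ord (x / y) = v.ord x - v.ord y := by
  rw [div_eq_mul_inv, ord_mul v hx (inv_ne_zero hy), ord_inv, sub_eq_add_neg]

/-- Since `ord 0` has the default value `0` rather than infinity, the bounds are asked of nonzero
summands only and the sum must be nonzero. -/
theorem le_ord_add {x y : L} {n : ℤ} (h : x + y ≠ 0) (hx : x ≠ 0 → n ≤ v.ord x)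
    (hy : y ≠ 0 → n ≤ v.ord y) : n ≤ v.ord (x + y) := by
  have key : ∀ z : L, (z ≠ 0 → n ≤ v.ord z) → v.val z ≤ exp (-n) := by
    intro z hz
    by_cases h0 : z = 0
    · simp [h0]
    · rw [val_eq_exp v h0, exp_le_exp]; linarith [hz h0]
  have := (v.val.map_add x y).trans (max_le (key x hx) (key y hy))
  rw [val_eq_exp v h, exp_le_exp] at this
  linarith

theorem exists_ord_eq_one : ∃ x : L, x ≠ 0 ∧ v.ord x = 1 := by
  obtain ⟨x, hx⟩ := (IsDiscreteValuationRing.maximalIdeal v.ring).valuation_exists_uniformizer L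
  refine ⟨x, ?_, by simp [Place.ord, hx]⟩
  rintro rfl
  rw [map_zero] at hx
  exact exp_ne_zero hx.symm

theorem ring_ne_top : v.ring ≠ ⊤ := by
  intro h
  obtain ⟨x, hx, h1⟩ := v.exists_ord_eq_one
  have := (v.ord_nonneg_iff (inv_ne_zero hx)).2 (by rw [h]; trivial)
  rw [ord_inv, h1] at this
  omega

theorem ext_ring {v w : Place L} (h : v.ring = w.ring) : v = w := by
  cases v; cases w; cases h; rfl

/-- A discrete valuation ring has rank one, so the only valuation ring strictly above it is the
whole field. -/
theorem eq_of_le {v w : Place L} (h : v.ring ≤ w.ring) : v = w :=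
  ext_ring (ValuationSubring.eq_of_le_of_ne_top _ h w.ring_ne_top)

theorem ord_pos_iff {x : L} (hx : x ≠ 0) : 0 < v.ord x ↔ x⁻¹ ∉ v.ring := by
  rw [← v.ord_nonneg_iff (inv_ne_zero hx), ord_inv]; omega

theorem mem_maximalIdeal_iff {x : v.ring} (hx : (x : L) ≠ 0) :
    x ∈ IsLocalRing.maximalIdeal v.ring ↔ 0 < v.ord x := by
  rw [v.ord_pos_iff hx, ← ValuationSubring.coe_mem_nonunits_iff,
    ValuationSubring.mem_nonunits_iff_or]
  simp [hx]

/-- A surjective discrete valuation with the same valuation ring gives the same order. -/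
theorem val_eq_of_valuationSubring (w : Valuation L (WithZero (Multiplicative ℤ)))
    (hw : w.valuationSubring = v.ring) (h1 : ∃ x, w x = exp (-1 : ℤ)) : w = v.val := by
  have hle : ∀ x, w x ≤ 1 ↔ v.val x ≤ 1 := fun x => by
    rw [v.val_le_one_iff, ← hw, Valuation.mem_valuationSubring_iff]
  have hE : w.IsEquiv v.val := Valuation.isEquiv_of_val_le_one hle
  obtain ⟨π, hπ0, hπ⟩ := v.exists_ord_eq_one
  have hvπ : v.val π = exp (-1 : ℤ) := by rw [val_eq_exp v hπ0, hπ]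
  have hwπ0 : w π ≠ 0 := by simpa using hπ0
  -- Division by a power of `π` leaves a unit of the common valuation ring, so `w` is determined by
  -- `w π`.
  have hwpow : ∀ x, x ≠ 0 → w x = w π ^ (v.ord x) := by
    intro x hx
    have h2 : v.val (x * (π ^ v.ord x)⁻¹) = 1 := by
      rw [map_mul, map_inv₀, map_zpow₀, hvπ, val_eq_exp v hx, ← exp_zsmul, ← exp_neg, ← exp_add]
      simp
    have h3 := (hE.eq_one_iff_eq_one).2 h2
    rw [map_mul, map_inv₀, map_zpow₀, mul_inv_eq_one₀ (zpow_ne_zero _ hwπ0)] at h3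
    exact h3
  have hwπ : w π = exp (log (w π)) := (exp_log hwπ0).symm
  have hπlt : w π < 1 := by
    rw [hE.lt_one_iff_lt_one, hvπ, ← exp_zero, exp_lt_exp]; norm_num
  -- An element of value `exp (-1)` is a unit times a power of `π`, so the positive integer `-log (w
  -- π)` divides `1`.
  have hlog : log (w π) = -1 := by
    obtain ⟨x, hx⟩ := h1
    have hx0 : x ≠ 0 := by
      rintro rfl
      rw [map_zero] at hx
      exact exp_ne_zero hx.symm
    have h4 := hwpow x hx0
    rw [hx, hwπ, ← exp_zsmul, exp_inj] at h4
    rw [hwπ, ← exp_zero, exp_lt_exp] at hπlt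
    have h5 : (-log (w π)) ∣ 1 := ⟨v.ord x, by simp only [smul_eq_mul] at h4; linarith⟩
    have := Int.eq_one_of_dvd_one (by omega) h5
    omega
  ext x
  by_cases hx : x = 0
  · simp [hx]
  · rw [hwpow x hx, hwπ, hlog, val_eq_exp v hx, ← exp_zsmul]; simp

end Place

variable {L : Type*} [Field L]

theorem mem_integers_iff {P : Place L} {x : L} :
    x ∈ integers P ↔ ∀ v : Place L, v ≠ P → x ∈ v.ring := by
  simp [integers, Subring.mem_iInf]

variable (ℓ : ℕ) [Fact ℓ.Prime] [Algebra (ZMod ℓ) L]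

theorem algebraMap_zmod_mem (V : ValuationSubring L) (a : ZMod ℓ) :
    algebraMap (ZMod ℓ) L a ∈ V := by
  obtain ⟨n, rfl⟩ := ZMod.natCast_zmod_surjective a
  rw [map_natCast]
  exact natCast_mem V n

variable {ℓ}

theorem mem_of_mem_constants (V : ValuationSubring L) {x : L} (hx : x ∈ constants ℓ L) :
    x ∈ V := by
  have hc : IsIntegral (ZMod ℓ) x := (mem_algebraicClosure_iff.mp hx).isIntegral
  let φ : ZMod ℓ →+* V := (algebraMap (ZMod ℓ) L).codRestrict V (algebraMap_zmod_mem ℓ V)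
  obtain ⟨f, hf, hfc⟩ := hc
  have hi : IsIntegral V x := ⟨f.map φ, hf.map φ, by rw [Polynomial.eval₂_map]; exact hfc⟩
  obtain ⟨y, hy⟩ := IsIntegrallyClosed.isIntegral_iff.mp hi
  rw [← hy]
  exact y.2

theorem ord_eq_zero_of_mem_constants (v : Place L) {x : L} (hx : x ∈ constants ℓ L) :
    v.ord x = 0 := by
  have h1 := v.ord_nonneg (mem_of_mem_constants v.ring hx)
  have h2 := v.ord_nonneg (mem_of_mem_constants v.ring (inv_mem hx))
  rw [ord_inv] at h2
  omega

theorem mem_constants_of_pow {x : L} {n : ℕ} (hn : 0 < n) (hx : x ^ n ∈ constants ℓ L) :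
    x ∈ constants ℓ L := by
  rw [mem_algebraicClosure_iff] at hx ⊢
  exact hx.of_pow hn

end GlobalFF

/-! ### Valuation rings of a global function field; functions without poles -/

namespace GlobalFF

open IsDedekindDomain WithZero Polynomial

/-- A nonempty sum of nonzero elements with pairwise distinct valuations does not vanish. -/
theorem _root_.Valuation.sum_ne_zero_of_injOn {K Γ ι : Type*} [Field K]
    [LinearOrderedCommGroupWithZero Γ] (v : Valuation K Γ) {s : Finset ι} (hs : s.Nonempty)
    {f : ι → K} (h0 : ∀ i ∈ s, f i ≠ 0) (hinj : Set.InjOn (fun i => v (f i)) s) :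
    ∑ i ∈ s, f i ≠ 0 := by
  classical
  obtain ⟨j, hj, hmax⟩ := s.exists_max_image (fun i => v (f i)) hs
  have hv : v (f j) ≠ 0 := by simpa using h0 j hj
  have : v (∑ i ∈ s, f i) = v (f j) := by
    refine v.map_sum_eq_of_lt hj fun i hi => ?_
    rw [Finset.mem_sdiff, Finset.mem_singleton] at hi
    exact lt_of_le_of_ne (hmax i hi.1) fun h => hi.2 (hinj hi.1 hj h)
  intro h
  rw [h, map_zero] at this
  exact hv this.symm

/-- As `v` is trivial on coefficients and `1 < v g`, the leading term of each nonzero `f i`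
determines the value of `aeval g (f i)`, a power of `v g`. The nonzero terms then have distinct
values and cannot cancel. This yields linear independence over polynomials in `g`. -/
theorem eq_zero_of_sum_aeval_mul_eq_zero {C K Γ ι : Type*} [CommRing C] [Field K]
    [Algebra C K] [LinearOrderedCommGroupWithZero Γ] (v : Valuation K Γ) [v.IsTrivialOn C]
    {g : K} (hg : 1 < v g) {y : ι → K} (hy : ∀ i, y i ≠ 0)
    (hinj : ∀ i j, i ≠ j → ∀ m n : ℕ, v g ^ m * v (y i) ≠ v g ^ n * v (y j))
    {s : Finset ι} {f : ι → C[X]} (h : ∑ i ∈ s, aeval g (f i) * y i = 0) :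
    ∀ i ∈ s, f i = 0 := by
  classical
  by_contra! hne
  obtain ⟨i, hi, hfi⟩ := hne
  have hval : ∀ j, f j ≠ 0 → v (aeval g (f j) * y j) = v g ^ (f j).natDegree * v (y j) :=
    fun j hj => by
      rw [map_mul, valuation_aeval_eq_valuation_X_pow_natDegree_of_one_lt_valuation_X g hg hj]
  have hpos : v g ≠ 0 := (zero_lt_one.trans hg).ne'
  refine v.sum_ne_zero_of_injOn (s := s.filter fun j => f j ≠ 0)
    ⟨i, Finset.mem_filter.2 ⟨hi, hfi⟩⟩ (f := fun j => aeval g (f j) * y j) ?_ ?_ ?_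
  · intro j hj
    have hj' := (Finset.mem_filter.1 hj).2
    rw [← v.ne_zero_iff, hval j hj']
    exact mul_ne_zero (pow_ne_zero _ hpos) (v.ne_zero_iff.2 (hy j))
  · intro j hj k hk hjk
    by_contra hne
    have hj' := (Finset.mem_filter.1 hj).2
    have hk' := (Finset.mem_filter.1 hk).2
    simp only [hval j hj', hval k hk'] at hjk
    exact hinj j k hne _ _ hjk
  · rw [← h]
    refine Finset.sum_subset (Finset.filter_subset _ _) fun j hj hj' => ?_
    have : f j = 0 := by
      by_contra h0
      exact hj' (Finset.mem_filter.2 ⟨hj, h0⟩)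
    simp [this]

variable {L : Type*} [Field L] {ℓ : ℕ} [Fact ℓ.Prime] [Algebra (ZMod ℓ) L]

instance (V : ValuationSubring L) : V.valuation.IsTrivialOn (ZMod ℓ) where
  eq_one a ha := by
    have hu : IsUnit (⟨_, algebraMap_zmod_mem ℓ V a⟩ : V) := by
      refine IsUnit.of_mul_eq_one ⟨_, algebraMap_zmod_mem ℓ V a⁻¹⟩ (Subtype.ext ?_)
      change algebraMap (ZMod ℓ) L a * algebraMap (ZMod ℓ) L a⁻¹ = 1
      rw [← map_mul, mul_inv_cancel₀ ha, map_one]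
    exact (V.valuation_eq_one_iff _).1 hu

instance (v : Place L) : v.val.IsTrivialOn (constants ℓ L) where
  eq_one a ha := by
    have h0 : (a : L) ≠ 0 := by simpa using ha
    change v.val (a : L) = 1
    rw [v.val_eq_exp h0, ord_eq_zero_of_mem_constants v a.2, neg_zero, exp_zero]

theorem transcendental_of_notMem_constants {x : L} (hx : x ∉ constants ℓ L) :
    Transcendental (ZMod ℓ) x := fun h => hx (mem_algebraicClosure_iff.2 h)

namespace IsGlobalFunctionField

variable (hL : IsGlobalFunctionField ℓ L)
include hL

/-- The field has transcendence degree at most one, so `x` alone is a transcendence basis. A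
finitely generated algebraic extension of `𝔽_ℓ(x)` is finite. -/
theorem finiteDimensional_adjoin {x : L} (hx : Transcendental (ZMod ℓ) x) :
    FiniteDimensional (ZMod ℓ)⟮x⟯ L := by
  obtain ⟨t, ht, hfin⟩ := hL
  have hfg : Algebra.EssFiniteType (ZMod ℓ) (ZMod ℓ)⟮t⟯ :=
    (IntermediateField.essFiniteType_iff).2
      (IntermediateField.fg_adjoin_of_finite (Set.finite_singleton t))
  have h1 : Algebra.EssFiniteType (ZMod ℓ) L := Algebra.EssFiniteType.comp _ (ZMod ℓ)⟮t⟯ _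
  have h2 : Algebra.EssFiniteType (ZMod ℓ)⟮x⟯ L := Algebra.EssFiniteType.of_comp (ZMod ℓ) _ _
  have htr : Algebra.trdeg (ZMod ℓ) L ≤ 1 := by
    have : Algebra.IsAlgebraic (Algebra.adjoin (ZMod ℓ) {t}) L := by
      open scoped IntermediateField.algebraAdjoinAdjoin in
      exact Algebra.IsAlgebraic.trans _ (ZMod ℓ)⟮t⟯ _
    simpa using Algebra.IsAlgebraic.trdeg_le_cardinalMk (ZMod ℓ) {t}
  have hb : IsTranscendenceBasis (ZMod ℓ) (fun _ : Unit => x) :=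
    AlgebraicIndependent.isTranscendenceBasis_of_lift_trdeg_le_of_finite
      (algebraicIndependent_unique_type_iff.2 hx) (by simpa using htr)
  have halg := hb.isAlgebraic_field
  rw [Set.range_const] at halg
  exact Algebra.finite_of_essFiniteType_of_isAlgebraic

theorem isAlgebraic_algebraAdjoin {x : L} (hx : Transcendental (ZMod ℓ) x) :
    Algebra.IsAlgebraic (Algebra.adjoin (ZMod ℓ) {x}) L := by
  have := hL.finiteDimensional_adjoin hx
  open scoped IntermediateField.algebraAdjoinAdjoin in
  exact Algebra.IsAlgebraic.trans _ (ZMod ℓ)⟮x⟯ _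

/-- The values of the `y i` lie between `(v g)⁻¹` and `1`, the latter excluded. Distinct values in
this interval never differ by a power of `v g`, so the `y i` are linearly independent over `𝔽_ℓ(g)`.
Only finitely many values can therefore occur there. -/
theorem card_le_finrank (V : ValuationSubring L) {g : L} (hg : 1 < V.valuation g) {ι : Type*}
    [Fintype ι] {y : ι → L} (hy : ∀ i, 1 ≤ V.valuation g * V.valuation (y i))
    (hy' : ∀ i, V.valuation (y i) < 1) (hinj : ∀ i j, i ≠ j → V.valuation (y i) ≠ V.valuation (y j)) :
    Fintype.card ι ≤ Module.finrank (ZMod ℓ)⟮g⟯ L := by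
  have hpos : V.valuation g ≠ 0 := (zero_lt_one.trans hg).ne'
  have htr : Transcendental (ZMod ℓ) g :=
    V.valuation.transcendental_of_ne_one _ g (V.valuation.ne_zero_iff.1 hpos) hg.ne'
  have := hL.finiteDimensional_adjoin htr
  have key : ∀ i j, ∀ m n : ℕ, m < n →
      V.valuation g ^ m * V.valuation (y i) ≠ V.valuation g ^ n * V.valuation (y j) := by
    intro i j m n hmn h
    obtain ⟨k, rfl⟩ := Nat.exists_eq_add_of_lt hmn
    rw [show m + k + 1 = m + (k + 1) by ring, pow_add, mul_assoc] at h
    have h' := mul_left_cancel₀ (pow_ne_zero m hpos) h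
    have h1 : 1 ≤ V.valuation (y i) := by
      rw [h', pow_succ, mul_assoc]
      exact one_le_mul (one_le_pow₀ hg.le) (hy j)
    exact absurd (hy' i) (not_lt.2 h1)
  have hli : LinearIndependent (Algebra.adjoin (ZMod ℓ) {g}) y := by
    rw [Fintype.linearIndependent_iff]
    intro a ha
    have hex : ∀ i, ∃ f : (ZMod ℓ)[X], aeval g f = (a i : L) := by
      intro i
      have hle := (Algebra.adjoin_singleton_eq_range_aeval (ZMod ℓ) g).le
      exact hle (a i).2
    choose f hf using hex
    have hy0 : ∀ i, y i ≠ 0 := by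
      intro i h
      have := hy i
      rw [h, map_zero, mul_zero] at this
      exact absurd this (by simp)
    have := eq_zero_of_sum_aeval_mul_eq_zero V.valuation hg (s := Finset.univ) (f := f) hy0 ?_ ?_
    · intro i
      apply Subtype.ext
      rw [← hf i, this i (Finset.mem_univ i)]
      simp
    · intro i j hij m n h
      rcases lt_trichotomy m n with hmn | rfl | hmn
      · exact key i j m n hmn h
      · exact hinj i j hij (mul_left_cancel₀ (pow_ne_zero m hpos) h)
      · exact key j i n m hmn h.symm
    · rw [← ha]
      exact Finset.sum_congr rfl fun i _ => by rw [hf i]; rfl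
  have hli' : LinearIndependent (ZMod ℓ)⟮g⟯ y := by
    open scoped IntermediateField.algebraAdjoinAdjoin in
    exact (LinearIndependent.iff_fractionRing (Algebra.adjoin (ZMod ℓ) {g}) (ZMod ℓ)⟮g⟯).1 hli
  exact hli'.fintype_card_le_finrank

/-- Every nontrivial valuation ring of a global function field is discrete. -/
theorem isDiscreteValuationRing {V : ValuationSubring L} (hV : V ≠ ⊤) :
    IsDiscreteValuationRing V := by
  have hnf : IsLocalRing.maximalIdeal V ≠ ⊥ := by
    intro h
    refine hV (eq_top_iff.2 fun x _ => ?_)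
    by_contra hx
    have hx' : x⁻¹ ∈ V := (V.mem_or_inv_mem x).resolve_left hx
    have : (⟨x⁻¹, hx'⟩ : V) ∈ IsLocalRing.maximalIdeal V := by
      rw [← ValuationSubring.coe_mem_nonunits_iff, ValuationSubring.inv_mem_nonunits_iff]
      exact Or.inr hx
    rw [h, Ideal.mem_bot] at this
    have h0 : x = 0 := by simpa using congrArg Subtype.val this
    exact hx (h0 ▸ V.zero_mem)
  have hpir : IsPrincipalIdealRing V := by
    refine ⟨fun I => ?_⟩
    by_cases hI : I = ⊥
    · rw [hI]; infer_instance
    by_cases hI' : I = ⊤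
    · rw [hI']; infer_instance
    obtain ⟨x, hx, hx0⟩ := Submodule.exists_mem_ne_zero_of_ne_bot hI
    have hlt : ∀ y ∈ I, V.valuation (y : L) < 1 := fun y hy =>
      (V.valuation_lt_one_iff y).1 (IsLocalRing.le_maximalIdeal hI' hy)
    have hx0' : (x : L) ≠ 0 := by simpa using hx0
    -- The values on `I` that are at least the value of `x` lie below `1`, so `card_le_finrank` with
    -- `g = x⁻¹` makes them finite in number. An element of `I` of greatest value divides all the
    -- others.
    let S : Set V.ValueGroup := {γ | ∃ y ∈ I, V.valuation (y : L) = γ ∧ V.valuation (x : L) ≤ γ}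
    have hvx : V.valuation (x : L) ≠ 0 := V.valuation.ne_zero_iff.2 hx0'
    have hg : 1 < V.valuation (x : L)⁻¹ := by
      rw [map_inv₀]
      exact (one_lt_inv₀ (zero_lt_iff.2 hvx)).2 (hlt x hx)
    have hS : S.Finite := by
      by_contra hinf
      obtain ⟨T, hTS, hT⟩ := Set.Infinite.exists_subset_card_eq hinf
        (Module.finrank (ZMod ℓ)⟮(x : L)⁻¹⟯ L + 1)
      have hch : ∀ γ : T, ∃ y ∈ I, V.valuation (y : L) = γ ∧ V.valuation (x : L) ≤ γ :=
        fun γ => hTS γ.2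
      choose y hyI hyv hyx using hch
      have := hL.card_le_finrank V hg (y := fun γ : T => (y γ : L)) ?_ (fun γ => hlt _ (hyI γ)) ?_
      · rw [Fintype.card_coe, hT] at this
        omega
      · intro γ
        simp only [hyv]
        rw [map_inv₀]
        exact (one_le_inv_mul₀ (zero_lt_iff.2 hvx)).2 (hyx γ)
      · intro γ δ hne h
        simp only [hyv] at h
        exact hne (Subtype.ext h)
    obtain ⟨γ, ⟨y, hyI, hy, hxy⟩, hmax⟩ := hS.exists_maximal ⟨_, x, hx, rfl, le_rfl⟩
    refine ⟨y, le_antisymm (fun z hz => ?_) ((Ideal.span_singleton_le_iff_mem I).2 hyI)⟩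
    have hzy : V.valuation (z : L) ≤ V.valuation (y : L) := by
      rcases le_total (V.valuation (z : L)) (V.valuation (y : L)) with h | h
      · exact h
      · rw [hy]
        exact hmax ⟨z, hz, rfl, hxy.trans (hy ▸ h)⟩ (hy ▸ h)
    obtain ⟨a, ha⟩ := (V.valuation_le_iff _ _).1 hzy
    exact Ideal.mem_span_singleton'.2 ⟨a, Subtype.ext ha⟩
  exact { hpir with not_a_field' := hnf }

/-- The prime of a global function field given by a nontrivial valuation ring. -/
def place {V : ValuationSubring L} (hV : V ≠ ⊤) : Place L := ⟨V, hL.isDiscreteValuationRing hV⟩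

/-- A function without poles is constant. -/
theorem mem_constants_of_forall_mem {x : L} (hx : ∀ v : Place L, x ∈ v.ring) :
    x ∈ constants ℓ L := by
  -- The valuation rings of a field intersect in the integral closure of its prime ring; the trivial
  -- one imposes no condition.
  have h1 : x ∈ (integralClosure (Subring.closure (∅ : Set L)) L).toSubring := by
    rw [← iInf_valuationSubring_superset, Subring.mem_iInf]
    rintro ⟨V, -⟩
    by_cases hV : V = ⊤
    · subst hV; trivial
    · exact hx (hL.place hV)
  obtain ⟨f, hf, hfx⟩ := h1
  have hmem : ∀ a : Subring.closure (∅ : Set L), ∃ b : ZMod ℓ, algebraMap (ZMod ℓ) L b = a := by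
    intro a
    have : (Subring.closure (∅ : Set L)) ≤ (algebraMap (ZMod ℓ) L).range := by
      rw [Subring.closure_le]; exact Set.empty_subset _
    exact this a.2
  rw [mem_algebraicClosure_iff]
  have hlift : f.map (algebraMap (Subring.closure (∅ : Set L)) L) ∈
      Polynomial.lifts (algebraMap (ZMod ℓ) L) := by
    rw [Polynomial.lifts_iff_coeff_lifts]
    intro n
    rw [coeff_map]
    exact hmem _
  obtain ⟨p, hp, -, hpm⟩ := Polynomial.lifts_and_natDegree_eq_and_monic hlift (hf.map _)
  exact ⟨p, hpm.ne_zero, by rw [aeval_def, ← eval_map, hp, eval_map]; exact hfx⟩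

end IsGlobalFunctionField

end GlobalFF

/-! ### Functions with a single pole as a free module over `κ[g]` -/

namespace GlobalFF

open IsDedekindDomain WithZero Polynomial

variable {L : Type*} [Field L] {ℓ : ℕ} [Fact ℓ.Prime] [Algebra (ZMod ℓ) L]

/-- The inclusion of the field of constants in the ring of functions without poles outside `P`. -/
noncomputable instance (P : Place L) : Algebra (constants ℓ L) (integers P) :=
  ((algebraMap (constants ℓ L) L).codRestrict (integers P) fun c =>
    mem_integers_iff.2 fun v _ => mem_of_mem_constants v.ring c.2).toAlgebra

instance (P : Place L) : IsScalarTower (constants ℓ L) (integers P) L :=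
  IsScalarTower.of_algebraMap_eq fun _ => rfl

/-- At a prime of degree one, every regular function is congruent to a constant. -/
theorem Place.exists_sub_mem_maximalIdeal {P : Place L} (hP : P.degree ℓ = 1) {x : L}
    (hx : x ∈ P.ring) :
    ∃ c ∈ constants ℓ L, x - c ≠ 0 → 0 < P.ord (x - c) := by
  obtain ⟨e⟩ := Module.nonempty_linearEquiv_of_finrank_eq_one (R := constants ℓ L) hP
  obtain ⟨c, hc⟩ := (bijective_algebraMap_of_linearEquiv e).2
    (IsLocalRing.residue P.ring ⟨x, hx⟩)
  have hcr : (c : L) ∈ P.ring := Place.constants_mem ℓ P c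
  refine ⟨c, c.2, fun h => (P.mem_maximalIdeal_iff (x := ⟨x - c, sub_mem hx hcr⟩) h).1 ?_⟩
  have hsub : (⟨x - c, sub_mem hx hcr⟩ : P.ring) = ⟨x, hx⟩ - algebraMap (constants ℓ L) P.ring c :=
    rfl
  rw [hsub, ← IsLocalRing.residue_eq_zero_iff, map_sub, ← hc, sub_eq_zero]
  rfl

theorem one_lt_val_of_ord_neg {v : Place L} {g : L} (hg : v.ord g < 0) : 1 < v.val g := by
  have h0 : g ≠ 0 := by
    rintro rfl
    simp [Place.ord] at hg
  rw [v.val_eq_exp h0, ← exp_zero, exp_lt_exp]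
  omega

theorem ord_aeval {v : Place L} {g : L} (hg : v.ord g < 0) {p : (constants ℓ L)[X]} (hp : p ≠ 0) :
    aeval g p ≠ 0 ∧ v.ord (aeval g p) = p.natDegree * v.ord g := by
  have h1 := one_lt_val_of_ord_neg hg
  have := valuation_aeval_eq_valuation_X_pow_natDegree_of_one_lt_valuation_X g h1 hp
  have h0 : aeval g p ≠ 0 := by
    rw [← v.val.ne_zero_iff, this]
    exact pow_ne_zero _ (zero_lt_one.trans h1).ne'
  have hg0 : g ≠ 0 := by
    rintro rfl
    simp [Place.ord] at hg
  refine ⟨h0, ?_⟩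
  rw [v.val_eq_exp h0, v.val_eq_exp hg0, ← exp_nsmul, exp_inj] at this
  simp only [nsmul_eq_mul] at this
  linarith

theorem ord_aeval_zmod {v : Place L} {g : L} (hg : v.ord g < 0) {p : (ZMod ℓ)[X]} (hp : p ≠ 0) :
    aeval g p ≠ 0 ∧ v.ord (aeval g p) = p.natDegree * v.ord g := by
  have hp' : p.map (algebraMap (ZMod ℓ) (constants ℓ L)) ≠ 0 := (Polynomial.map_ne_zero_iff
    (algebraMap (ZMod ℓ) (constants ℓ L)).injective).2 hp
  have := ord_aeval hg hp'
  rwa [aeval_map_algebraMap, natDegree_map] at this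

namespace IsGlobalFunctionField

variable (hL : IsGlobalFunctionField ℓ L) {P : Place L}
include hL

theorem mem_constants_of_ord_nonneg {f : L} (hf : f ∈ integers P) (h : 0 ≤ P.ord f) :
    f ∈ constants ℓ L := by
  by_cases h0 : f = 0
  · rw [h0]; exact zero_mem _
  refine hL.mem_constants_of_forall_mem fun v => ?_
  by_cases hv : v = P
  · rw [hv]; exact (P.ord_nonneg_iff h0).1 h
  · exact mem_integers_iff.1 hf v hv

theorem ord_nonpos {f : L} (hf : f ∈ integers P) : P.ord f ≤ 0 := by
  by_contra h
  have := ord_eq_zero_of_mem_constants P (hL.mem_constants_of_ord_nonneg hf (not_le.1 h).le)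
  omega

theorem ord_neg_of_notMem {f : L} (hf : f ∈ integers P) (hc : f ∉ constants ℓ L) :
    P.ord f < 0 := by
  by_contra h
  exact hc (hL.mem_constants_of_ord_nonneg hf (not_lt.1 h))

/-- Some nonzero multiple of `y` by a polynomial in `g` is integral over `𝔽_ℓ[g]`. That ring lies in
every valuation ring other than that of `P`, and these are integrally closed. -/
theorem exists_aeval_mul_mem_integers {g : L} (hg : g ∈ integers P) (hgc : g ∉ constants ℓ L)
    (y : L) : ∃ p : (ZMod ℓ)[X], p ≠ 0 ∧ aeval g p * y ∈ integers P := by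
  have := hL.isAlgebraic_algebraAdjoin (transcendental_of_notMem_constants hgc)
  obtain ⟨d, hd0, hd⟩ := (this.isAlgebraic y).exists_integral_multiple
  have hle : ∀ a : Algebra.adjoin (ZMod ℓ) {g}, ∃ p : (ZMod ℓ)[X], aeval g p = (a : L) :=
    fun a => (Algebra.adjoin_singleton_eq_range_aeval (ZMod ℓ) g).le a.2
  obtain ⟨p, hp⟩ := hle d
  refine ⟨p, ?_, ?_⟩
  · rintro rfl
    exact hd0 (Subtype.ext (by simpa using hp.symm))
  rw [hp, mem_integers_iff]
  intro v hv
  have hsub : ∀ a : Algebra.adjoin (ZMod ℓ) {g}, (a : L) ∈ v.ring := by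
    intro a
    obtain ⟨p, hp⟩ := hle a
    rw [← hp, aeval_eq_sum_range]
    refine sum_mem fun i _ => ?_
    rw [Algebra.smul_def]
    exact mul_mem (algebraMap_zmod_mem ℓ v.ring _) (pow_mem (mem_integers_iff.1 hg v hv) _)
  obtain ⟨f, hf, hfd⟩ := hd
  let φ : Algebra.adjoin (ZMod ℓ) {g} →+* v.ring :=
    (algebraMap (Algebra.adjoin (ZMod ℓ) {g}) L).codRestrict v.ring hsub
  have hi : IsIntegral v.ring (d • y) :=
    ⟨f.map φ, hf.map φ, by rw [Polynomial.eval₂_map]; exact hfd⟩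
  obtain ⟨z, hz⟩ := IsIntegrallyClosed.isIntegral_iff.mp hi
  have hdy : (d : L) * y = z := hz.symm
  rw [hdy]
  exact z.2

/-- Multiplication by a polynomial in `g` changes the order at `P` by a multiple of `ord_P(g)`. The
poles of `π ^ m` elsewhere can thus be cleared without leaving the residue class. -/
theorem exists_modEq {g : L} (hg : g ∈ integers P) (hgc : g ∉ constants ℓ L) (m : ℤ) :
    ∃ f ∈ integers P, f ≠ 0 ∧ P.ord f ≡ m [ZMOD P.ord g] := by
  obtain ⟨π, hπ0, hπ⟩ := P.exists_ord_eq_one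
  have hy0 : π ^ m ≠ 0 := zpow_ne_zero _ hπ0
  have hy : P.ord (π ^ m) = m := by
    have h := P.val_eq_exp hy0
    rw [map_zpow₀, P.val_eq_exp hπ0, hπ, ← exp_zsmul, exp_inj] at h
    simp only [smul_eq_mul] at h
    linarith
  obtain ⟨p, hp, hpy⟩ := hL.exists_aeval_mul_mem_integers hg hgc (π ^ m)
  obtain ⟨h0, h1⟩ := ord_aeval_zmod (hL.ord_neg_of_notMem hg hgc) hp
  refine ⟨_, hpy, mul_ne_zero h0 hy0, ?_⟩
  rw [ord_mul P h0 hy0, h1, hy]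
  exact (Int.modEq_iff_dvd.2 ⟨-p.natDegree, by ring⟩)

/-- In each residue class of orders modulo `ord_P(g)` there is a function of smallest pole order. -/
theorem exists_maximal_ord {g : L} (hg : g ∈ integers P) (hgc : g ∉ constants ℓ L) (m : ℤ) :
    ∃ b ∈ integers P, b ≠ 0 ∧ P.ord b ≡ m [ZMOD P.ord g] ∧
      ∀ f ∈ integers P, f ≠ 0 → P.ord f ≡ m [ZMOD P.ord g] → P.ord f ≤ P.ord b := by
  classical
  have hex : ∃ n : ℕ, ∃ f ∈ integers P, f ≠ 0 ∧ P.ord f ≡ m [ZMOD P.ord g] ∧ P.ord f = -n := by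
    obtain ⟨f, hf, hf0, hfm⟩ := hL.exists_modEq hg hgc m
    exact ⟨(-P.ord f).toNat, f, hf, hf0, hfm, by have := hL.ord_nonpos hf; omega⟩
  obtain ⟨b, hb, hb0, hbm, hbn⟩ := Nat.find_spec hex
  refine ⟨b, hb, hb0, hbm, fun f hf hf0 hfm => ?_⟩
  have := Nat.find_min' hex ⟨f, hf, hf0, hfm, show P.ord f = -((-P.ord f).toNat : ℤ) by
    have := hL.ord_nonpos hf; omega⟩
  have h2 := hL.ord_nonpos hf
  omega

end IsGlobalFunctionField

/-- The ring of functions without poles outside `P` as an algebra over polynomials, the variable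
acting through `g`. -/
@[reducible] noncomputable def polynomialAlgebra (ℓ : ℕ) [Fact ℓ.Prime] [Algebra (ZMod ℓ) L]
    {P : Place L} (g : integers P) : Algebra (constants ℓ L)[X] (integers P) :=
  (aeval g : (constants ℓ L)[X] →ₐ[constants ℓ L] integers P).toRingHom.toAlgebra

/-- The basis consists of one function of smallest pole order in each residue class modulo
`ord_P(g)`. Distinct classes prevent cancellation, which gives independence. For generation, any `f`
has the same order as some `g ^ e * b i`. Since `P` has degree one, a constant multiple of the
latter cancels the leading term of `f`, and induction on the pole order applies. -/
theorem IsGlobalFunctionField.nonempty_basis (hL : IsGlobalFunctionField ℓ L) {P : Place L}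
    (hP : P.degree ℓ = 1) (g : integers P) (hgc : (g : L) ∉ constants ℓ L) :
    letI := polynomialAlgebra ℓ g
    Nonempty (Module.Basis (Fin (-P.ord (g : L)).toNat) (constants ℓ L)[X] (integers P)) := by
  let := polynomialAlgebra ℓ g
  have hord := hL.ord_neg_of_notMem g.2 hgc
  have hg0 : (g : L) ≠ 0 := fun h => hgc (h ▸ zero_mem _)
  set n := (-P.ord (g : L)).toNat with hn
  have hnn : (n : ℤ) = -P.ord (g : L) := by omega
  choose b hbO hb0 hbm hbmax using fun i : Fin n => hL.exists_maximal_ord g.2 hgc (i : ℤ)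
  have hmodn : ∀ x y : ℤ, x ≡ y [ZMOD P.ord (g : L)] ↔ x ≡ y [ZMOD n] := by
    intro x y
    rw [hnn, Int.modEq_iff_dvd, Int.modEq_iff_dvd, neg_dvd]
  have hsmul : ∀ (p : (constants ℓ L)[X]) (f : integers P),
      ((p • f : integers P) : L) = aeval (g : L) p * f := by
    intro p f
    rw [Algebra.smul_def]
    change ((aeval g p * f : integers P) : L) = _
    rw [Subring.coe_mul]
    congr 1
    exact (aeval_algebraMap_apply L g p).symm
  refine ⟨Module.Basis.mk (v := fun i => (⟨b i, hbO i⟩ : integers P)) ?_ ?_⟩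
  · rw [Fintype.linearIndependent_iff]
    intro f hf i
    refine eq_zero_of_sum_aeval_mul_eq_zero P.val (one_lt_val_of_ord_neg hord) hb0 ?_
      (s := Finset.univ) (f := f) ?_ i (Finset.mem_univ i)
    · intro i j hij r s h
      apply hij
      rw [P.val_eq_exp hg0, P.val_eq_exp (hb0 i), P.val_eq_exp (hb0 j), ← exp_nsmul, ← exp_nsmul,
        ← exp_add, ← exp_add, exp_inj] at h
      simp only [nsmul_eq_mul] at h
      have h1 := (hbm i).symm.trans ((Int.modEq_iff_dvd.2 ⟨(r : ℤ) - s, by linarith⟩ :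
        P.ord (b i) ≡ P.ord (b j) [ZMOD P.ord (g : L)]).trans (hbm j))
      rw [hmodn] at h1
      have h2 := Int.ModEq.eq h1
      rw [Int.emod_eq_of_lt (by omega) (by omega), Int.emod_eq_of_lt (by omega) (by omega)] at h2
      exact Fin.ext (by exact_mod_cast h2)
    · have := congrArg (fun x : integers P => (x : L)) hf
      simpa [hsmul] using this
  · suffices H : ∀ (m : ℕ) (f : L) (hf : f ∈ integers P), f ≠ 0 → P.ord f = -m →
        (⟨f, hf⟩ : integers P) ∈ Submodule.span (constants ℓ L)[X]
          (Set.range fun i => (⟨b i, hbO i⟩ : integers P)) by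
      rintro ⟨f, hf⟩ -
      by_cases h0 : f = 0
      · subst h0; exact zero_mem _
      · exact H (-P.ord f).toNat f hf h0 (by have := hL.ord_nonpos hf; omega)
    intro m
    induction m using Nat.strong_induction_on with
    | _ m ih =>
      intro f hf hf0 hfm
      have hnpos : (0 : ℤ) < n := by omega
      obtain ⟨i, hi⟩ : ∃ i : Fin n, P.ord f ≡ i [ZMOD P.ord (g : L)] := by
        have h1 := Int.emod_nonneg (P.ord f) hnpos.ne'
        have h2 := Int.emod_lt_of_pos (P.ord f) hnpos
        refine ⟨⟨(P.ord f % n).toNat, by omega⟩, ?_⟩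
        rw [hmodn]
        simp only [Int.toNat_of_nonneg h1]
        exact (Int.mod_modEq _ _).symm
      have hle := hbmax i f hf hf0 hi
      -- Here `ord b - ord f = ord g * d`. Maximality of `ord b` and `ord g < 0` give `d ≤ 0`, so
      -- the exponent `e = -d` of `g` is a natural number.
      obtain ⟨d, hd⟩ := Int.modEq_iff_dvd.1 (hi.trans (hbm i).symm)
      have hd0 : d ≤ 0 := by
        by_contra hd0
        nlinarith
      obtain ⟨e, rfl⟩ : ∃ e : ℕ, d = -e := ⟨d.natAbs, by omega⟩
      set u : L := (g : L) ^ e * b i with hu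
      have hu0 : u ≠ 0 := mul_ne_zero (pow_ne_zero _ hg0) (hb0 i)
      have huf : P.ord u = P.ord f := by
        rw [hu, ord_mul P (pow_ne_zero _ hg0) (hb0 i), P.ord_pow]
        linarith
      have huO : u ∈ integers P := mul_mem (pow_mem g.2 _) (hbO i)
      obtain ⟨c, hc, hcord⟩ := P.exists_sub_mem_maximalIdeal hP (x := f / u)
        ((P.ord_nonneg_iff (div_ne_zero hf0 hu0)).1 (by rw [P.ord_div hf0 hu0, huf, sub_self]))
      have hcO : c ∈ integers P := mem_integers_iff.2 fun v _ => mem_of_mem_constants v.ring hc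
      have hsub : f - c * u = (f / u - c) * u := by field_simp
      have hmem : f - c * u ∈ integers P := sub_mem hf (mul_mem hcO huO)
      have h1 : (⟨f - c * u, hmem⟩ : integers P) ∈ Submodule.span (constants ℓ L)[X]
          (Set.range fun i => (⟨b i, hbO i⟩ : integers P)) := by
        by_cases h0 : f - c * u = 0
        · simp only [h0]; exact zero_mem _
        · have h2 : f / u - c ≠ 0 := fun h => h0 (by rw [hsub, h, zero_mul])
          have h3 := hcord h2
          have h4 : P.ord (f - c * u) = P.ord (f / u - c) + P.ord u := by
            rw [hsub, ord_mul P h2 hu0]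
          have h5 := hL.ord_nonpos hmem
          exact ih (-P.ord (f - c * u)).toNat (by omega) _ hmem h0 (by omega)
      have h2 : (⟨c * u, mul_mem hcO huO⟩ : integers P) ∈ Submodule.span (constants ℓ L)[X]
          (Set.range fun i => (⟨b i, hbO i⟩ : integers P)) := by
        have : (⟨c * u, mul_mem hcO huO⟩ : integers P) =
            (C (⟨c, hc⟩ : constants ℓ L) * X ^ e) • (⟨b i, hbO i⟩ : integers P) := by
          apply Subtype.ext
          rw [hsmul, map_mul, aeval_C, map_pow, aeval_X]
          change c * u = c * (g : L) ^ e * b i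
          rw [hu, mul_assoc]
        rw [this]
        exact Submodule.smul_mem _ _ (Submodule.subset_span ⟨i, rfl⟩)
      have := add_mem h1 h2
      convert this using 1
      exact Subtype.ext (by simp)

end GlobalFF

/-! ### The Dedekind domain `integers P` and the degree of a principal divisor -/

namespace GlobalFF

open IsDedekindDomain WithZero Polynomial

variable {L : Type*} [Field L] {ℓ : ℕ} [Fact ℓ.Prime] [Algebra (ZMod ℓ) L]

namespace IsGlobalFunctionField

variable (hL : IsGlobalFunctionField ℓ L) {P : Place L}
include hL

theorem isFractionRing_integers {g : L} (hg : g ∈ integers P) (hgc : g ∉ constants ℓ L) :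
    IsFractionRing (integers P) L := by
  refine .of_field _ _ fun x => ?_
  obtain ⟨p, hp, hpx⟩ := hL.exists_aeval_mul_mem_integers hg hgc x
  obtain ⟨h0, -⟩ := ord_aeval_zmod (hL.ord_neg_of_notMem hg hgc) hp
  have hmem : aeval g p ∈ integers P := by
    rw [aeval_eq_sum_range]
    refine sum_mem fun i _ => ?_
    rw [Algebra.smul_def]
    exact mul_mem (mem_integers_iff.2 fun v _ => algebraMap_zmod_mem ℓ v.ring _) (pow_mem hg _)
  refine ⟨⟨_, hpx⟩, ⟨_, hmem⟩, ?_⟩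
  change x = aeval g p * x / aeval g p
  field_simp

/-- Finiteness over `κ[g]` gives the Noetherian property and dimension at most one. Integral
closedness holds because the ring is an intersection of valuation rings. -/
theorem isDedekindDomain_integers (hP : P.degree ℓ = 1) {g : L} (hg : g ∈ integers P)
    (hgc : g ∉ constants ℓ L) : IsDedekindDomain (integers P) := by
  let := polynomialAlgebra ℓ (⟨g, hg⟩ : integers P)
  obtain ⟨b⟩ := hL.nonempty_basis hP ⟨g, hg⟩ hgc
  have hfin : Module.Finite (constants ℓ L)[X] (integers P) := Module.Finite.of_basis b
  have hfrac := hL.isFractionRing_integers hg hgc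
  have hint : Algebra.IsIntegral (constants ℓ L)[X] (integers P) := Algebra.IsIntegral.of_finite _ _
  have : IsDedekindRing (integers P) := by
    refine (isDedekindRing_iff (integers P) L).2
      ⟨IsNoetherianRing.of_finite (constants ℓ L)[X] _,
        Ring.DimensionLEOne.of_isIntegral (constants ℓ L)[X] _, fun {x} hx => ?_⟩
    refine ⟨⟨x, mem_integers_iff.2 fun v hv => ?_⟩, rfl⟩
    have hle : integers P ≤ v.ring.toSubring := fun y hy => mem_integers_iff.1 hy v hv
    obtain ⟨f, hf, hfx⟩ := hx
    have hi : IsIntegral v.ring x :=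
      ⟨f.map (Subring.inclusion hle), hf.map _, by rw [Polynomial.eval₂_map]; exact hfx⟩
    obtain ⟨z, hz⟩ := IsIntegrallyClosed.isIntegral_iff.mp hi
    rw [← hz]
    exact z.2
  exact { this with }

end IsGlobalFunctionField

section HeightOne

variable (hL : IsGlobalFunctionField ℓ L) {P : Place L} [IsDedekindDomain (integers P)]
  [IsFractionRing (integers P) L]

theorem valuationSubring_ne_top (q : HeightOneSpectrum (integers P)) :
    (q.valuation L).valuationSubring ≠ ⊤ := by
  rw [ne_eq, Valuation.valuationSubring_eq_top_iff, not_not]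
  infer_instance

/-- The prime of a global function field given by a maximal ideal of `integers P`. -/
noncomputable def IsGlobalFunctionField.placeOf (q : HeightOneSpectrum (integers P)) : Place L :=
  hL.place (valuationSubring_ne_top q)

theorem val_placeOf (q : HeightOneSpectrum (integers P)) :
    (hL.placeOf q).val = q.valuation L := by
  refine ((hL.placeOf q).val_eq_of_valuationSubring _ rfl ?_).symm
  obtain ⟨π, hπ⟩ := q.valuation_exists_uniformizer L
  exact ⟨π, hπ⟩

theorem ord_placeOf (q : HeightOneSpectrum (integers P)) {f : integers P} (hf : f ≠ 0) :
    (hL.placeOf q).ord (f : L) = multiplicity q.asIdeal (Ideal.span {f}) := by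
  have h0 : (f : L) ≠ 0 := fun h => hf (Subtype.ext h)
  have h1 := (hL.placeOf q).val_eq_exp h0
  have h2 : q.valuation L (f : L) = q.intValuation f := q.valuation_of_algebraMap f
  rw [val_placeOf, h2, q.intValuation_eq_exp_neg_multiplicity hf, exp_inj] at h1
  linarith

theorem placeOf_ne (q : HeightOneSpectrum (integers P)) {g : L} (hg : g ∈ integers P)
    (hgc : g ∉ constants ℓ L) : hL.placeOf q ≠ P := by
  intro h
  have h1 := hL.ord_neg_of_notMem hg hgc
  rw [← h] at h1
  have h2 : g ∈ (hL.placeOf q).ring := q.valuation_le_one (K := L) ⟨g, hg⟩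
  have := (hL.placeOf q).ord_nonneg h2
  omega

theorem placeOf_injective : Function.Injective (hL.placeOf (P := P)) := by
  intro p q h
  have h1 := congrArg Place.val h
  rw [val_placeOf, val_placeOf] at h1
  exact HeightOneSpectrum.eq_of_valuation_isEquiv_valuation (K := L) (by rw [h1])

theorem exists_placeOf_eq {v : Place L} (hv : v ≠ P) {g : integers P} (hg0 : g ≠ 0)
    (hg : 0 < v.ord (g : L)) :
    ∃ q : HeightOneSpectrum (integers P), hL.placeOf q = v ∧ g ∈ q.asIdeal := by
  have hle : integers P ≤ v.ring.toSubring := fun y hy => mem_integers_iff.1 hy v hv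
  let φ : integers P →+* v.ring := Subring.inclusion hle
  let I := (IsLocalRing.maximalIdeal v.ring).comap φ
  have h0 : (g : L) ≠ 0 := fun h => hg0 (Subtype.ext h)
  have hgI : g ∈ I := (v.mem_maximalIdeal_iff (x := φ g) h0).2 hg
  have hI : I ≠ ⊥ := fun h => hg0 (by rwa [h, Ideal.mem_bot] at hgI)
  let q : HeightOneSpectrum (integers P) := ⟨I, Ideal.comap_isPrime _ _, hI⟩
  refine ⟨q, Place.eq_of_le ?_, hgI⟩
  intro x hx
  obtain ⟨n, d, hnd⟩ := q.exists_primeCompl_mul_eq_of_integer x hx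
  have hd : φ d ∉ IsLocalRing.maximalIdeal v.ring := d.2
  obtain ⟨u, hu⟩ := (IsLocalRing.notMem_maximalIdeal.1 hd).exists_right_inv
  have hu' : (d : L) * (u : L) = 1 := congrArg Subtype.val hu
  have hnd' : x * (d : L) = (n : L) := hnd
  have : x = (n : L) * u := by rw [← hnd', mul_assoc, hu', mul_one]
  rw [this]
  exact mul_mem (hle n.2) u.2

/-- The residue field of a maximal ideal of `integers P` is that of the corresponding prime. -/
theorem degree_placeOf (q : HeightOneSpectrum (integers P)) :
    (hL.placeOf q).degree ℓ = Module.finrank (constants ℓ L) (integers P ⧸ q.asIdeal) := by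
  set v := hL.placeOf q
  have hle : integers P ≤ v.ring.toSubring := fun y hy => q.valuation_le_one (K := L) ⟨y, hy⟩
  let φ : integers P →+* v.ring := Subring.inclusion hle
  let ψ : integers P →+* IsLocalRing.ResidueField v.ring := (IsLocalRing.residue v.ring).comp φ
  have hker : ∀ a, ψ a = 0 ↔ a ∈ q.asIdeal := by
    intro a
    rw [← q.valuation_lt_one_iff_mem (K := L), RingHom.comp_apply,
      IsLocalRing.residue_eq_zero_iff]
    exact Valuation.mem_maximalIdeal_iff L (q.valuation L) (a := φ a)
  have hsurj : Function.Surjective ψ := by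
    intro y
    obtain ⟨⟨x, hx⟩, rfl⟩ := IsLocalRing.residue_surjective y
    obtain ⟨a, ha⟩ := q.exists_valuation_sub_lt_of_integer (K := L) (x := x) hx 1
    refine ⟨a, ?_⟩
    rw [RingHom.comp_apply, ← sub_eq_zero, ← map_sub, IsLocalRing.residue_eq_zero_iff]
    exact (Valuation.mem_maximalIdeal_iff L (q.valuation L)).2 ha
  have : q.asIdeal.IsMaximal := q.isMaximal
  let e : (integers P ⧸ q.asIdeal) ≃+* IsLocalRing.ResidueField v.ring :=
    (Ideal.quotEquivOfEq (Ideal.ext fun a => by rw [RingHom.mem_ker, hker])).trans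
      (RingHom.quotientKerEquivOfSurjective hsurj)
  exact (Algebra.finrank_eq_of_equiv_equiv (RingEquiv.refl (constants ℓ L)) e
    (RingHom.ext fun c => rfl)).symm

end HeightOne

/-- A nonconstant function whose only pole is a prime of degree one has a divisor, and this
divisor has degree zero. -/
theorem IsGlobalFunctionField.exists_divisor (hL : IsGlobalFunctionField ℓ L) {P : Place L}
    (hP : P.degree ℓ = 1) {g : L} (hg : g ∈ integers P) (hgc : g ∉ constants ℓ L) :
    ∃ D : Divisor L, (∀ v, D v = v.ord g) ∧ degHom ℓ L D = 0 := by
  classical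
  have := hL.isFractionRing_integers hg hgc
  have := hL.isDedekindDomain_integers hP hg hgc
  have hord := hL.ord_neg_of_notMem hg hgc
  let γ : integers P := ⟨g, hg⟩
  have hγ0 : γ ≠ 0 := fun h => hgc (by rw [show g = 0 from congrArg Subtype.val h]; exact zero_mem _)
  let := polynomialAlgebra ℓ γ
  obtain ⟨b⟩ := hL.nonempty_basis hP γ hgc
  have hfin : Module.Finite (constants ℓ L)[X] (integers P) := Module.Finite.of_basis b
  have hfree : Module.Free (constants ℓ L)[X] (integers P) := Module.Free.of_basis b
  have hrank := Module.finrank_eq_card_basis b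
  have hst : IsScalarTower (constants ℓ L) (constants ℓ L)[X] (integers P) :=
    IsScalarTower.of_algebraMap_eq fun c =>
      ((aeval γ : (constants ℓ L)[X] →ₐ[constants ℓ L] integers P).commutes c).symm
  -- The prime `(X)` of `κ[X]` generates the ideal `(g)`, so the primes above it are the zeros of
  -- `g`. Ramification index is the order of `g` and inertia degree is the degree of the prime. The
  -- identity `∑ e f = rank` then equates the number of zeros with the pole order.
  let p : Ideal (constants ℓ L)[X] := Ideal.span {X - C 0}
  have hpmax : p.IsMaximal := by
    have := (Polynomial.quotientSpanXSubCAlgEquiv (0 : constants ℓ L)).toMulEquiv.isField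
      (Field.toIsField _)
    exact Ideal.Quotient.maximal_of_isField _ this
  have hpmap : p.map (algebraMap (constants ℓ L)[X] (integers P)) = Ideal.span {γ} := by
    rw [Ideal.map_span, Set.image_singleton]
    congr 2
    change aeval γ (X - C 0) = γ
    simp
  have hpne : p.map (algebraMap (constants ℓ L)[X] (integers P)) ≠ ⊥ := by
    rw [hpmap, ne_eq, Ideal.span_singleton_eq_bot]
    exact hγ0
  let : Fintype (p.primesOver (integers P)) :=
    (Algebra.QuasiFinite.finite_primesOver p).fintype
  have hsum := Ideal.sum_ramification_inertia_eq_finrank p (integers P)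
  let spec : p.primesOver (integers P) → HeightOneSpectrum (integers P) := fun q =>
    ⟨q.1, q.2.1, fun h => hpne (by
      have := q.2.2
      rw [eq_bot_iff, ← h]
      exact Ideal.map_le_of_le_comap (q.1.over_def p).le)⟩
  have hram : ∀ q : p.primesOver (integers P),
      (hL.placeOf (spec q)).ord g = q.1.ramificationIdx (constants ℓ L)[X] := by
    intro q
    have := q.2.1
    have := q.2.2
    rw [Ideal.IsDedekindDomain.ramificationIdx_eq_multiplicity p q.1 hpne, hpmap]
    exact ord_placeOf hL (spec q) hγ0
  have hdeg : ∀ q : p.primesOver (integers P),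
      (hL.placeOf (spec q)).degree ℓ = q.1.inertiaDeg (constants ℓ L)[X] := by
    intro q
    have := q.2.1
    have := q.2.2
    have : q.1.IsMaximal := (spec q).isMaximal
    rw [degree_placeOf, Ideal.inertiaDeg_eq_of_isMaximal p q.1]
    refine Algebra.finrank_eq_of_equiv_equiv
      (Polynomial.quotientSpanXSubCAlgEquiv (0 : constants ℓ L)).symm.toRingEquiv
      (RingEquiv.refl _) (RingHom.ext fun c => ?_)
    change algebraMap ((constants ℓ L)[X] ⧸ p) (integers P ⧸ q.1)
      ((Polynomial.quotientSpanXSubCAlgEquiv (0 : constants ℓ L)).symm c) = _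
    have : (Polynomial.quotientSpanXSubCAlgEquiv (0 : constants ℓ L)).symm c =
        Ideal.Quotient.mk p (C c) :=
      (Polynomial.quotientSpanXSubCAlgEquiv (0 : constants ℓ L)).symm.commutes c
    rw [this]
    change Ideal.Quotient.mk q.1 (aeval γ (C c)) = _
    rw [aeval_C]
    rfl
  have hspec : Function.Injective spec := fun q r h => by
    apply Subtype.ext
    exact congrArg HeightOneSpectrum.asIdeal h
  refine ⟨Finsupp.single P (P.ord g) + ∑ q, Finsupp.single (hL.placeOf (spec q))
    ((hL.placeOf (spec q)).ord g), fun v => ?_, ?_⟩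
  · rw [Finsupp.add_apply, Finsupp.finsetSum_apply]
    by_cases hv : v = P
    · subst hv
      rw [Finsupp.single_eq_same, Finset.sum_eq_zero, add_zero]
      intro q _
      exact Finsupp.single_eq_of_ne (placeOf_ne hL (spec q) hg hgc).symm
    · rw [Finsupp.single_eq_of_ne hv, zero_add]
      have h0 := v.ord_nonneg (mem_integers_iff.1 hg v hv)
      rcases h0.eq_or_lt with h0 | h0
      · rw [← h0]
        refine Finset.sum_eq_zero fun q _ => ?_
        by_cases hq : v = hL.placeOf (spec q)
        · rw [← hq, Finsupp.single_eq_same, h0]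
        · exact Finsupp.single_eq_of_ne hq
      · obtain ⟨q, hq, hgq⟩ := exists_placeOf_eq hL hv hγ0 h0
        have hlies : q.asIdeal.LiesOver p := by
          refine ⟨hpmax.eq_of_le (Ideal.comap_ne_top _ q.isPrime.ne_top) ?_⟩
          rw [← Ideal.map_le_iff_le_comap, hpmap, Ideal.span_singleton_le_iff_mem]
          exact hgq
        let q' : p.primesOver (integers P) := ⟨q.asIdeal, q.isPrime, hlies⟩
        have hq' : hL.placeOf (spec q') = v := hq
        rw [Finset.sum_eq_single q', hq', Finsupp.single_eq_same]
        · intro r _ hr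
          refine Finsupp.single_eq_of_ne fun h => hr (hspec (placeOf_injective hL ?_))
          rw [hq', h]
        · intro h
          exact absurd (Finset.mem_univ _) h
  · rw [map_add, map_sum]
    simp only [degHom, Finsupp.liftAddHom_apply_single, AddMonoidHom.coe_mulRight, hP, hram, hdeg]
    have : (∑ q : p.primesOver (integers P), (q.1.ramificationIdx (constants ℓ L)[X] : ℤ) *
        (q.1.inertiaDeg (constants ℓ L)[X] : ℤ)) = (-P.ord g).toNat := by
      rw [hrank, Fintype.card_fin] at hsum
      exact_mod_cast hsum
    rw [this]
    push_cast
    omega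

end GlobalFF

/-! ### Powers up to constants, and equations between powers -/

namespace GlobalFF

open WithZero

variable {L : Type*} [Field L] {ℓ : ℕ} [Fact ℓ.Prime] [Algebra (ZMod ℓ) L]

/-- The order of the class of `E` divides both `q` and the class number. Finiteness of the class
group need not be known: an infinite group has `Nat.card` equal to `0`, which `q` divides. -/
theorem mem_principal_of_nsmul_mem {q : ℕ} (hq : q.Prime) (hcl : ¬ q ∣ classNumber ℓ L)
    {E : Divisor L} (hdeg : degHom ℓ L E = 0) (hE : q • E ∈ principal L) : E ∈ principal L := by
  let e : (degHom ℓ L).ker := ⟨E, hdeg⟩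
  let x : ClassGroupZero ℓ L := QuotientAddGroup.mk e
  have hx : q • x = 0 := (QuotientAddGroup.eq_zero_iff (q • e)).2 hE
  have h1 : addOrderOf x ∣ q := addOrderOf_dvd_of_nsmul_eq_zero hx
  rcases (Nat.dvd_prime hq).1 h1 with h | h
  · rw [AddMonoid.addOrderOf_eq_one_iff] at h
    exact (QuotientAddGroup.eq_zero_iff e).1 h
  · exact absurd (h ▸ addOrderOf_dvd_natCard x) hcl

theorem natCast_ne_zero_of_prime_ne {q : ℕ} (hq : q.Prime) (hqℓ : q ≠ ℓ) : (q : L) ≠ 0 := by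
  have : CharP L ℓ := charP_of_injective_algebraMap (algebraMap (ZMod ℓ) L).injective ℓ
  rw [ne_eq, CharP.cast_eq_zero_iff L ℓ]
  exact fun h => hqℓ ((Nat.prime_dvd_prime_iff_eq Fact.out hq).1 h).symm

theorem natCast_mem_constants (n : ℕ) : (n : L) ∈ constants ℓ L := natCast_mem _ n

/-- If `z` is congruent to a nonzero constant `c` at `v`, then `(z ^ m - c ^ m) / (z - c)` is a
unit at `v`, provided that `m` is invertible. -/
theorem ord_sub_eq_ord_pow_sub_pow {v : Place L} {z c : L} (hz : z ∈ v.ring)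
    (hc : c ∈ constants ℓ L) (hc0 : c ≠ 0) {m : ℕ} (hm : (m : L) ≠ 0)
    (hpos : 0 < v.ord (z - c)) : v.ord (z ^ m - c ^ m) = v.ord (z - c) := by
  have hcr := mem_of_mem_constants v.ring hc
  have h0 : z - c ≠ 0 := by
    intro h
    rw [h] at hpos
    simp [Place.ord] at hpos
  let Z : v.ring := ⟨z, hz⟩
  let C : v.ring := ⟨c, hcr⟩
  let G : v.ring := ∑ i ∈ Finset.range m, Z ^ i * C ^ (m - 1 - i)
  have hG : z ^ m - c ^ m = (G : L) * (z - c) := by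
    have := (Commute.all Z C).geom_sum₂_mul m
    exact (congrArg Subtype.val this).symm
  have hr : IsLocalRing.residue v.ring Z = IsLocalRing.residue v.ring C := by
    rw [← sub_eq_zero, ← map_sub, IsLocalRing.residue_eq_zero_iff]
    exact (v.mem_maximalIdeal_iff (x := Z - C) h0).2 hpos
  -- Modulo the maximal ideal `z` equals `c`, so the cofactor becomes `m * c ^ (m - 1)`, a nonzero
  -- constant.
  have hrG : IsLocalRing.residue v.ring G = IsLocalRing.residue v.ring (m * C ^ (m - 1)) := by
    rw [map_sum]
    simp only [map_mul, map_pow, hr]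
    rw [geom_sum₂_self, map_natCast]
  have hk : (m : L) * c ^ (m - 1) ≠ 0 := mul_ne_zero hm (pow_ne_zero _ hc0)
  have hGmem : G ∉ IsLocalRing.maximalIdeal v.ring := by
    rw [← IsLocalRing.residue_eq_zero_iff, hrG, IsLocalRing.residue_eq_zero_iff,
      v.mem_maximalIdeal_iff (x := (m * C ^ (m - 1) : v.ring)) hk, not_lt]
    exact (ord_eq_zero_of_mem_constants v
      (mul_mem (natCast_mem_constants m) (pow_mem hc (m - 1)))).le
  have hG0 : (G : L) ≠ 0 := fun h => hGmem (by rw [show G = 0 from Subtype.ext h]; exact zero_mem _)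
  have h1 := v.ord_nonneg G.2
  rw [v.mem_maximalIdeal_iff hG0, not_lt] at hGmem
  rw [hG, ord_mul v hG0 h0]
  omega

namespace IsGlobalFunctionField

variable (hL : IsGlobalFunctionField ℓ L) {P : Place L}
include hL

/-- Both factors have nonpositive order at `P`, and these orders add up to zero. -/
theorem mem_constants_of_mul_mem {f g : L} (hf : f ∈ integers P) (hg : g ∈ integers P)
    (h0 : f * g ≠ 0) (h : f * g ∈ constants ℓ L) : f ∈ constants ℓ L := by
  refine hL.mem_constants_of_ord_nonneg hf ?_
  have h1 := ord_eq_zero_of_mem_constants P h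
  rw [ord_mul P (left_ne_zero_of_mul h0) (right_ne_zero_of_mul h0)] at h1
  have := hL.ord_nonpos hg
  omega

omit hL in
theorem sub_mem_integers {f c : L} (hf : f ∈ integers P) (hc : c ∈ constants ℓ L) :
    f - c ∈ integers P :=
  sub_mem hf (mem_integers_iff.2 fun v _ => mem_of_mem_constants v.ring hc)

/-- A difference of `n`-th powers is a nonzero constant only if the functions are constant. -/
theorem mem_constants_of_pow_sub_pow {n : ℕ} (hn : 1 < n) (hnL : (n : L) ≠ 0) {s t : L}
    (hs : s ∈ integers P) (ht : t ∈ integers P) (h0 : s ^ n - t ^ n ≠ 0)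
    (h : s ^ n - t ^ n ∈ constants ℓ L) : s ∈ constants ℓ L ∧ t ∈ constants ℓ L := by
  have hfac := (Commute.all s t).geom_sum₂_mul n
  have hG : ∑ i ∈ Finset.range n, s ^ i * t ^ (n - 1 - i) ∈ integers P :=
    sum_mem fun i _ => mul_mem (pow_mem hs _) (pow_mem ht _)
  have hst : s - t ∈ constants ℓ L :=
    hL.mem_constants_of_mul_mem (sub_mem hs ht) hG (by rwa [mul_comm, hfac])
      (by rwa [mul_comm, hfac])
  have hst0 : s - t ≠ 0 := fun h' => h0 (by rw [← hfac, h', mul_zero])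
  have hGc : ∑ i ∈ Finset.range n, s ^ i * t ^ (n - 1 - i) ∈ constants ℓ L :=
    hL.mem_constants_of_mul_mem hG (sub_mem hs ht) (by rwa [hfac]) (by rwa [hfac])
  suffices ht' : t ∈ constants ℓ L from ⟨by simpa using add_mem hst ht', ht'⟩
  by_contra htc
  have hord := hL.ord_neg_of_notMem ht htc
  have ht0 : t ≠ 0 := fun h => htc (h ▸ zero_mem _)
  have hw : 0 < P.ord (s / t - 1) := by
    rw [div_sub_one ht0, P.ord_div hst0 ht0, ord_eq_zero_of_mem_constants P hst]
    omega
  have hw' : s / t ∈ P.ring := by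
    have : s / t - 1 ≠ 0 := by
      intro h
      rw [h] at hw
      simp [Place.ord] at hw
    simpa using add_mem ((P.ord_nonneg_iff this).1 hw.le) P.ring.one_mem
  -- If `t` has a pole, then `s / t` is congruent to `1` at `P`. The orders of `s / t - 1` and `(s /
  -- t) ^ n - 1`, namely `-ord t` and `-n * ord t`, would have to agree, which is impossible for `n
  -- > 1`.
  have h1 := ord_sub_eq_ord_pow_sub_pow hw' (one_mem (constants ℓ L)) one_ne_zero hnL hw
  have h2 : (s / t) ^ n - 1 ^ n = (s ^ n - t ^ n) / t ^ n := by
    rw [div_pow, one_pow, div_sub_one (pow_ne_zero _ ht0)]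
  rw [h2, div_sub_one ht0, P.ord_div h0 (pow_ne_zero _ ht0), P.ord_div hst0 ht0,
    ord_eq_zero_of_mem_constants P hst, ord_eq_zero_of_mem_constants P h, P.ord_pow] at h1
  have : (1 : ℤ) < n := by exact_mod_cast hn
  nlinarith

/-- If `Z ^ m - c ^ m` is a `q`-th power, then so is `Z - c` up to a constant, when `q` does not
divide the class number. -/
theorem exists_sub_eq_mul_pow (hP : P.degree ℓ = 1) {q m : ℕ} (hq : q.Prime)
    (hcl : ¬ q ∣ classNumber ℓ L) (hm : (m : L) ≠ 0) {Z W c : L} (hZ : Z ∈ integers P)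
    (hZc : Z ∉ constants ℓ L) (hc : c ∈ constants ℓ L)
    (hc0 : c ≠ 0) (h : Z ^ m - c ^ m = W ^ q) :
    ∃ z ∈ integers P, ∃ u ∈ constants ℓ L, u ≠ 0 ∧ z ≠ 0 ∧ Z - c = u * z ^ q := by
  classical
  have hg : Z - c ∈ integers P := sub_mem_integers hZ hc
  have hgc : Z - c ∉ constants ℓ L := fun h' => hZc (by simpa using add_mem h' hc)
  have hg0 : Z - c ≠ 0 := fun h' => hgc (h' ▸ zero_mem _)
  obtain ⟨D, hD, hdeg⟩ := hL.exists_divisor hP hg hgc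
  -- At a zero of `Z - c` the other factor of `Z ^ m - c ^ m = W ^ q` is a unit, so the order is `q`
  -- times that of `W`.
  have hfin : ∀ v, v ≠ P → (q : ℤ) ∣ D v := by
    intro v hv
    rw [hD]
    rcases (v.ord_nonneg (mem_integers_iff.1 hg v hv)).eq_or_lt with h0 | h0
    · rw [← h0]; exact dvd_zero _
    · rw [← ord_sub_eq_ord_pow_sub_pow (mem_integers_iff.1 hZ v hv) hc hc0 hm h0, h, v.ord_pow]
      exact dvd_mul_right _ _
  -- As `P` has degree one and `D` has degree zero, the coefficient at `P` is minus the weighted sum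
  -- of the others.
  have hinf : (q : ℤ) ∣ D P := by
    have h1 : degHom ℓ L D = D P + ∑ v ∈ D.support.erase P, D v * (v.degree ℓ : ℤ) := by
      have : degHom ℓ L D = D.sum fun v n => n * (v.degree ℓ : ℤ) := rfl
      rw [this]
      by_cases hPD : P ∈ D.support
      · rw [Finsupp.sum, ← Finset.add_sum_erase _ _ hPD, hP]; simp
      · rw [Finset.erase_eq_of_notMem hPD, Finsupp.notMem_support_iff.1 hPD, zero_add]; rfl
    rw [hdeg] at h1
    have h2 : (q : ℤ) ∣ ∑ v ∈ D.support.erase P, D v * (v.degree ℓ : ℤ) :=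
      Finset.dvd_sum fun v hv => (hfin v (Finset.ne_of_mem_erase hv)).mul_right _
    rw [show D P = -∑ v ∈ D.support.erase P, D v * (v.degree ℓ : ℤ) by linarith]
    exact h2.neg_right
  have hall : ∀ v, (q : ℤ) ∣ D v := fun v => by
    by_cases hv : v = P
    · rw [hv]; exact hinf
    · exact hfin v hv
  let E : Divisor L := D.mapRange (· / (q : ℤ)) (Int.zero_ediv _)
  have hqE : q • E = D := by
    ext v
    rw [Finsupp.smul_apply, Finsupp.mapRange_apply, nsmul_eq_mul, Int.mul_ediv_cancel' (hall v)]
  have hq0 : (q : ℤ) ≠ 0 := by exact_mod_cast hq.ne_zero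
  have hEdeg : degHom ℓ L E = 0 := by
    have : q • degHom ℓ L E = 0 := by rw [← map_nsmul, hqE, hdeg]
    rw [nsmul_eq_mul] at this
    exact (mul_eq_zero.1 this).resolve_left hq0
  obtain ⟨z, hz0, hz⟩ := mem_principal_of_nsmul_mem hq hcl hEdeg (hqE ▸ ⟨_, hg0, hD⟩)
  have hzq : ∀ v : Place L, (q : ℤ) * v.ord z = v.ord (Z - c) := fun v => by
    rw [← hz, ← hD, ← nsmul_eq_mul, ← Finsupp.smul_apply, hqE]
  have hzq0 : z ^ q ≠ 0 := pow_ne_zero _ hz0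
  refine ⟨z, mem_integers_iff.2 fun v hv => (v.ord_nonneg_iff hz0).1 ?_, (Z - c) / z ^ q,
    hL.mem_constants_of_forall_mem fun v => (v.ord_nonneg_iff (div_ne_zero hg0 hzq0)).1 ?_,
    div_ne_zero hg0 hzq0, hz0, by field_simp⟩
  · have h1 := v.ord_nonneg (mem_integers_iff.1 hg v hv)
    rw [← hzq] at h1
    exact nonneg_of_mul_nonneg_right h1 (by exact_mod_cast hq.pos)
  · rw [v.ord_div hg0 hzq0, v.ord_pow, hzq, sub_self]

/-- If `u₁ z₁ ^ n - u₂ z₂ ^ n` is a nonzero constant, with constants `u₁` and `u₂`, then `z₁` is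
constant. -/
theorem mem_constants_of_mul_pow_sub_mul_pow (hP : P.degree ℓ = 1) {n : ℕ} (hn : 1 < n)
    (hnL : (n : L) ≠ 0) {u₁ u₂ z₁ z₂ : L} (hu₁ : u₁ ∈ constants ℓ L) (hu₂ : u₂ ∈ constants ℓ L)
    (hu₁0 : u₁ ≠ 0) (hz₁ : z₁ ∈ integers P) (hz₂ : z₂ ∈ integers P)
    (h0 : u₁ * z₁ ^ n - u₂ * z₂ ^ n ≠ 0) (h : u₁ * z₁ ^ n - u₂ * z₂ ^ n ∈ constants ℓ L) :
    z₁ ∈ constants ℓ L := by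
  by_contra hc
  set d := u₁ * z₁ ^ n - u₂ * z₂ ^ n with hd
  have hord := hL.ord_neg_of_notMem hz₁ hc
  have hn0 : n ≠ 0 := by omega
  have hz₁0 : z₁ ≠ 0 := fun h => hc (h ▸ zero_mem _)
  have hn1 : (1 : ℤ) < n := by exact_mod_cast hn
  -- At a pole of `z₁` the term `d / z₁ ^ n` vanishes, so the residue `e` of `z₂ / z₁` should
  -- satisfy `e ^ n * u₂ = u₁`.
  have hw : (z₂ / z₁) ^ n * u₂ = u₁ - d / z₁ ^ n := by
    have hzn := pow_ne_zero n hz₁0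
    rw [hd, div_pow]; field_simp; ring
  have hdz : 0 < P.ord (d / z₁ ^ n) := by
    rw [P.ord_div h0 (pow_ne_zero _ hz₁0), ord_eq_zero_of_mem_constants P h, P.ord_pow]
    nlinarith
  have hu₂0 : u₂ ≠ 0 := by
    rintro rfl
    rw [mul_zero, eq_comm, sub_eq_zero] at hw
    rw [← hw, ord_eq_zero_of_mem_constants P hu₁] at hdz
    exact lt_irrefl _ hdz
  have hrd : d / z₁ ^ n ∈ P.ring :=
    (P.ord_nonneg_iff (div_ne_zero h0 (pow_ne_zero _ hz₁0))).1 hdz.le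
  have hwr : z₂ / z₁ ∈ P.ring := by
    have h1 : (z₂ / z₁) ^ n ∈ P.ring := by
      have : (z₂ / z₁) ^ n = (u₁ - d / z₁ ^ n) * u₂⁻¹ := by rw [← hw]; field_simp
      rw [this]
      exact mul_mem (sub_mem (mem_of_mem_constants P.ring hu₁) hrd)
        (mem_of_mem_constants P.ring (inv_mem hu₂))
    by_cases h2 : z₂ / z₁ = 0
    · rw [h2]; exact P.ring.zero_mem
    · have := P.ord_nonneg h1
      rw [P.ord_pow] at this
      exact (P.ord_nonneg_iff h2).1 (nonneg_of_mul_nonneg_right this (by omega))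
  obtain ⟨e, he, hwe⟩ := P.exists_sub_mem_maximalIdeal hP hwr
  have her := mem_of_mem_constants P.ring he
  -- The two constants are congruent at `P`, whereas a nonzero constant has order `0` there.
  have hlim : u₁ = e ^ n * u₂ := by
    by_contra hne
    have hne' : u₁ - e ^ n * u₂ ≠ 0 := sub_ne_zero.2 hne
    have h1 : P.ord (u₁ - e ^ n * u₂) = 0 :=
      ord_eq_zero_of_mem_constants P (sub_mem hu₁ (mul_mem (pow_mem he _) hu₂))
    have hG : ∑ i ∈ Finset.range n, (z₂ / z₁) ^ i * e ^ (n - 1 - i) ∈ P.ring :=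
      sum_mem fun i _ => mul_mem (pow_mem hwr _) (pow_mem her _)
    have hfac := (Commute.all (z₂ / z₁) e).geom_sum₂_mul n
    have h2 : u₁ - e ^ n * u₂ = d / z₁ ^ n + (∑ i ∈ Finset.range n,
        (z₂ / z₁) ^ i * e ^ (n - 1 - i)) * u₂ * (z₂ / z₁ - e) := by
      rw [show ∀ a : L, a * u₂ * (z₂ / z₁ - e) = a * (z₂ / z₁ - e) * u₂ by intro a; ring, hfac]
      linear_combination -hw
    have h3 : (1 : ℤ) ≤ P.ord (u₁ - e ^ n * u₂) := by
      rw [h2] at hne' ⊢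
      refine P.le_ord_add hne' (fun _ => hdz) fun h4 => ?_
      rw [ord_mul P (left_ne_zero_of_mul h4) (right_ne_zero_of_mul h4)]
      have := P.ord_nonneg (mul_mem hG (mem_of_mem_constants P.ring hu₂))
      have := hwe (right_ne_zero_of_mul h4)
      omega
    omega
  -- The constant `u₁` is absorbed into `z₁` through its factor `e ^ n`, which leaves a plain
  -- difference of `n`-th powers.
  have hsub : (e * z₁) ^ n - z₂ ^ n = d / u₂ := by
    rw [hd, hlim, mul_pow]; field_simp
  have heO : e ∈ integers P := mem_integers_iff.2 fun v _ => mem_of_mem_constants v.ring he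
  have he0 : e ≠ 0 := by
    rintro rfl
    exact hu₁0 (by rw [hlim, zero_pow hn0, zero_mul])
  have := (hL.mem_constants_of_pow_sub_pow hn hnL (mul_mem heO hz₁) hz₂
    (by rw [hsub]; exact div_ne_zero h0 hu₂0) (by rw [hsub]; exact div_mem h hu₂)).1
  exact hc (by simpa [he0] using mul_mem (inv_mem he) this)

/-- `Z ^ m - a` is a `q`-th power, with `a` a nonzero constant having two distinct constant `m`-th
roots, only if `Z` is constant, when `q` does not divide the class number. -/
theorem mem_constants_of_pow_sub_eq_pow (hP : P.degree ℓ = 1) {q m : ℕ} (hq : q.Prime)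
    (hqℓ : q ≠ ℓ) (hcl : ¬ q ∣ classNumber ℓ L) (hm : (m : L) ≠ 0) {Z W a c₁ c₂ : L}
    (hZ : Z ∈ integers P) (hc₁ : c₁ ^ m = a) (hc₂ : c₂ ^ m = a)
    (hc : c₁ ≠ c₂) (ha : a ∈ constants ℓ L) (ha0 : a ≠ 0) (h : Z ^ m - a = W ^ q) :
    Z ∈ constants ℓ L := by
  by_contra hZc
  have hm0 : m ≠ 0 := by rintro rfl; simp at hm
  have hk : ∀ c, c ^ m = a → c ∈ constants ℓ L ∧ c ≠ 0 := by
    rintro c rfl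
    exact ⟨mem_constants_of_pow (Nat.pos_of_ne_zero hm0) ha, fun h0 => ha0 (by rw [h0, zero_pow hm0])⟩
  obtain ⟨z₁, hz₁, u₁, hu₁, hu₁0, -, h₁⟩ := hL.exists_sub_eq_mul_pow hP hq hcl hm hZ hZc
    (hk c₁ hc₁).1 (hk c₁ hc₁).2 (by rwa [hc₁])
  obtain ⟨z₂, hz₂, u₂, hu₂, hu₂0, -, h₂⟩ := hL.exists_sub_eq_mul_pow hP hq hcl hm hZ hZc
    (hk c₂ hc₂).1 (hk c₂ hc₂).2 (by rwa [hc₂])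
  have hsub : u₁ * z₁ ^ q - u₂ * z₂ ^ q = c₂ - c₁ := by rw [← h₁, ← h₂]; ring
  have hz := hL.mem_constants_of_mul_pow_sub_mul_pow hP hq.one_lt
    (natCast_ne_zero_of_prime_ne hq hqℓ) hu₁ hu₂ hu₁0 hz₁ hz₂
    (by rw [hsub]; exact sub_ne_zero.2 hc.symm)
    (by rw [hsub]; exact sub_mem (hk c₂ hc₂).1 (hk c₁ hc₁).1)
  refine hZc ?_
  rw [show Z = u₁ * z₁ ^ q + c₁ by rw [← h₁]; ring]
  exact add_mem (mul_mem hu₁ (pow_mem hz _)) (hk c₁ hc₁).1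

end IsGlobalFunctionField

end GlobalFF

/-! ### Extension of degree-one primes to constant extensions -/

namespace GlobalFF

variable {F L : Type*} [Field F] [Field L] [Algebra F L] {ℓ : ℕ} [Fact ℓ.Prime]
  [Algebra (ZMod ℓ) F] [Algebra (ZMod ℓ) L] [IsScalarTower (ZMod ℓ) F L]

theorem IsGlobalFunctionField.of_finiteDimensional (hF : IsGlobalFunctionField ℓ F)
    [FiniteDimensional F L] : IsGlobalFunctionField ℓ L := by
  obtain ⟨t, ht, hfin⟩ := hF
  refine ⟨algebraMap F L t, (transcendental_algebraMap_iff (algebraMap F L).injective).2 ht, ?_⟩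
  have hmap : (ZMod ℓ)⟮t⟯.map (IsScalarTower.toAlgHom (ZMod ℓ) F L) =
      (ZMod ℓ)⟮algebraMap F L t⟯ := by
    rw [IntermediateField.adjoin_map, Set.image_singleton]; rfl
  rw [← hmap]
  have : Module.Finite (ZMod ℓ)⟮t⟯ L := Module.Finite.trans F L
  exact Module.Finite.of_equiv_equiv
    ((ZMod ℓ)⟮t⟯.equivMap (IsScalarTower.toAlgHom (ZMod ℓ) F L)).toRingEquiv (RingEquiv.refl L)
    (RingHom.ext fun x => rfl)

theorem algebraMap_mem_constants_iff {x : F} :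
    algebraMap F L x ∈ constants ℓ L ↔ x ∈ constants ℓ F := by
  rw [mem_algebraicClosure_iff, mem_algebraicClosure_iff,
    isAlgebraic_algebraMap_iff (algebraMap F L).injective]

/-- A valuation ring containing `F` contains everything integral over `F`, hence all of `L`. -/
theorem comap_ne_top [Algebra.IsAlgebraic F L] {V : ValuationSubring L} (hV : V ≠ ⊤) :
    V.comap (algebraMap F L) ≠ ⊤ := by
  intro h
  refine hV (eq_top_iff.2 fun x _ => ?_)
  have hle : ∀ a : F, algebraMap F L a ∈ V := fun a => by
    rw [← ValuationSubring.mem_comap, h]; trivial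
  obtain ⟨f, hf, hfx⟩ := (Algebra.IsAlgebraic.isAlgebraic (R := F) x).isIntegral
  let φ : F →+* V := (algebraMap F L).codRestrict V hle
  have hi : IsIntegral V x := ⟨f.map φ, hf.map φ, by rw [Polynomial.eval₂_map]; exact hfx⟩
  obtain ⟨z, hz⟩ := IsIntegrallyClosed.isIntegral_iff.mp hi
  rw [← hz]
  exact z.2

/-- Some valuation ring of `L` dominates the ring of `P`. A uniformizer stays a nonunit in it, so
the contraction to `F` is proper and, by rank one, equals the ring of `P`. -/
theorem exists_valuationSubring_comap_eq (P : Place F) :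
    ∃ W : ValuationSubring L, W ≠ ⊤ ∧ W.comap (algebraMap F L) = P.ring := by
  obtain ⟨W, hW, hloc⟩ := IsLocalRing.exists_factor_valuationRing
    ((algebraMap F L).comp P.ring.subtype)
  have hle : P.ring ≤ W.comap (algebraMap F L) := fun x hx => hW ⟨x, hx⟩
  have hne : W.comap (algebraMap F L) ≠ ⊤ := by
    intro h
    obtain ⟨π, hπ0, hπ⟩ := P.exists_ord_eq_one
    have hπr : π ∈ P.ring := (P.ord_nonneg_iff hπ0).1 (by omega)
    have hinv : algebraMap F L π⁻¹ ∈ W := by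
      rw [← ValuationSubring.mem_comap, h]; trivial
    have hu := hloc.map_nonunit ⟨π, hπr⟩ (IsUnit.of_mul_eq_one ⟨_, hinv⟩ (Subtype.ext (by
      change algebraMap F L π * algebraMap F L π⁻¹ = 1
      rw [← map_mul, mul_inv_cancel₀ hπ0, map_one])))
    have hmem : (⟨π, hπr⟩ : P.ring) ∈ IsLocalRing.maximalIdeal P.ring :=
      (P.mem_maximalIdeal_iff (x := ⟨π, hπr⟩) hπ0).2 (by
        change 0 < P.ord π
        omega)
    exact hmem hu
  refine ⟨W, ?_, (ValuationSubring.eq_of_le_of_ne_top _ hle hne).symm⟩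
  rintro rfl
  exact hne (eq_top_iff.2 fun _ _ => trivial)

theorem valuation_algebraMap_lt_one {P : Place F} {W : ValuationSubring L}
    (hW : W.comap (algebraMap F L) = P.ring) {x : F} (hx : x ≠ 0 → 0 < P.ord x) :
    W.valuation (algebraMap F L x) < 1 := by
  rw [← ValuationSubring.mem_nonunits_iff, ValuationSubring.mem_nonunits_iff_or]
  by_cases h0 : x = 0
  · left; rw [h0, map_zero]
  · right
    rw [← map_inv₀, ← ValuationSubring.mem_comap, hW]
    exact (P.ord_pos_iff h0).1 (hx h0)

theorem valuation_eq_one_of_mem_constants (W : ValuationSubring L) {d : L}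
    (hd : d ∈ constants ℓ L) (hd0 : d ≠ 0) : W.valuation d = 1 := by
  refine le_antisymm ((W.valuation_le_one_iff _).2 (mem_of_mem_constants W hd)) ?_
  have := (W.valuation_le_one_iff _).2 (mem_of_mem_constants W (inv_mem hd))
  rw [map_inv₀] at this
  exact (inv_le_one₀ (zero_lt_iff.2 (W.valuation.ne_zero_iff.2 hd0))).1 this

/-- In an extension generated by a constant, every function is, up to a function of the base, a
unit congruent to a constant at every valuation ring above a prime of degree one. -/
theorem exists_valuation_div_sub_lt_one (pb : PowerBasis F L) (hgen : pb.gen ∈ constants ℓ L)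
    {P : Place F} (hP : P.degree ℓ = 1) {y : L} (hy : y ≠ 0) :
    ∃ a : F, a ≠ 0 ∧ ∃ d ∈ constants ℓ L, d ≠ 0 ∧ ∀ W : ValuationSubring L,
      W.comap (algebraMap F L) = P.ring → W.valuation (y / algebraMap F L a - d) < 1 := by
  classical
  set b := pb.basis.repr y with hb
  have hb0 : b ≠ 0 := by simpa [hb] using hy
  obtain ⟨i₀, hi₀⟩ := Finsupp.ne_iff.1 hb0
  have hsum : ∑ i, algebraMap F L (b i) * pb.gen ^ (i : ℕ) = y := by
    have := pb.basis.sum_repr y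
    simpa [Algebra.smul_def] using this
  -- The coordinate `b j` of largest value serves as `a`: all `b i / b j` are regular at `P`, with
  -- constant residues `c i` and `c j ≠ 0`. Then `d = ∑ c i * gen ^ i` is nonzero by independence of
  -- the powers of the generator, and neither `a` nor `d` depends on `W`.
  obtain ⟨j, -, hj⟩ := Finset.exists_max_image Finset.univ (fun i => P.val (b i)) ⟨i₀, Finset.mem_univ _⟩
  have hbj : b j ≠ 0 := by
    rw [← P.val.ne_zero_iff]
    exact ((zero_lt_iff.2 (P.val.ne_zero_iff.2 hi₀)).trans_le (hj i₀ (Finset.mem_univ _))).ne'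
  have hmem : ∀ i, b i / b j ∈ P.ring := fun i => by
    rw [← P.val_le_one_iff, map_div₀]
    exact div_le_one_of_le₀ (hj i (Finset.mem_univ _)) zero_le
  choose c hc hcb using fun i => P.exists_sub_mem_maximalIdeal hP (hmem i)
  have hcj : c j ≠ 0 := by
    intro h
    have := hcb j
    rw [h, div_self hbj, sub_zero, ord_one] at this
    exact lt_irrefl _ (this one_ne_zero)
  refine ⟨b j, hbj, ∑ i, algebraMap F L (c i) * pb.gen ^ (i : ℕ), ?_, ?_, ?_⟩
  · exact sum_mem fun i _ => mul_mem (algebraMap_mem_constants_iff.2 (hc i)) (pow_mem hgen _)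
  · intro h
    have := Fintype.linearIndependent_iff.1 pb.basis.linearIndependent c
      (by simpa [Algebra.smul_def] using h) j
    exact hcj this
  · intro W hW
    have : y / algebraMap F L (b j) - ∑ i, algebraMap F L (c i) * pb.gen ^ (i : ℕ) =
        ∑ i, algebraMap F L (b i / b j - c i) * pb.gen ^ (i : ℕ) := by
      rw [← hsum, Finset.sum_div, ← Finset.sum_sub_distrib]
      refine Finset.sum_congr rfl fun i _ => ?_
      rw [map_sub, map_div₀]
      ring
    rw [this]
    refine W.valuation.map_sum_lt one_ne_zero fun i _ => ?_
    rw [map_mul]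
    exact mul_lt_one_of_lt_of_le (valuation_algebraMap_lt_one hW (hcb i))
      ((W.valuation_le_one_iff _).2 (mem_of_mem_constants W (pow_mem hgen _)))

theorem valuation_div_eq_one {W : ValuationSubring L} {x d : L} (hd : d ∈ constants ℓ L)
    (hd0 : d ≠ 0) (h : W.valuation (x - d) < 1) : W.valuation x = 1 := by
  have h1 := valuation_eq_one_of_mem_constants W hd hd0
  rw [← h1, show x = d + (x - d) by ring]
  exact W.valuation.map_add_eq_of_lt_left (by rwa [h1])

/-- Up to a factor `a` from `F` that is independent of the extension, `y` is a unit at every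
extension. Membership of `y` is thus decided by `a ∈ P.ring`. -/
theorem valuationSubring_unique (pb : PowerBasis F L) (hgen : pb.gen ∈ constants ℓ L)
    {P : Place F} (hP : P.degree ℓ = 1) {V W : ValuationSubring L}
    (hV : V.comap (algebraMap F L) = P.ring) (hW : W.comap (algebraMap F L) = P.ring) :
    V = W := by
  ext y
  by_cases hy : y = 0
  · rw [hy]; exact ⟨fun _ => W.zero_mem, fun _ => V.zero_mem⟩
  obtain ⟨a, ha, d, hd, hd0, h⟩ := exists_valuation_div_sub_lt_one pb hgen hP hy
  have ha' : algebraMap F L a ≠ 0 := by simpa using ha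
  have key : ∀ U : ValuationSubring L, U.comap (algebraMap F L) = P.ring →
      (y ∈ U ↔ a ∈ P.ring) := by
    intro U hU
    have h1 := valuation_div_eq_one hd hd0 (h U hU)
    rw [map_div₀, div_eq_one_iff_eq (U.valuation.ne_zero_iff.2 ha')] at h1
    rw [← U.valuation_le_one_iff, h1, U.valuation_le_one_iff, ← hU, ValuationSubring.mem_comap]
  rw [key V hV, key W hW]

/-- A unit `y` is congruent to `a * d` with `a` in `F` and `d` constant, and `a` is congruent to a
constant because `P` has degree one. This makes the residue field of the extension equal to the
constants of `L`. -/
theorem exists_constant_valuation_sub_lt_one (pb : PowerBasis F L)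
    (hgen : pb.gen ∈ constants ℓ L) {P : Place F} (hP : P.degree ℓ = 1) {W : ValuationSubring L}
    (hW : W.comap (algebraMap F L) = P.ring) {y : L} (hy : y ∈ W) :
    ∃ c ∈ constants ℓ L, W.valuation (y - c) < 1 := by
  rcases ((W.valuation_le_one_iff y).2 hy).lt_or_eq with hlt | heq
  · exact ⟨0, zero_mem _, by simpa using hlt⟩
  have hy0 : y ≠ 0 := by
    rintro rfl
    simp at heq
  obtain ⟨a, ha, d, hd, hd0, h⟩ := exists_valuation_div_sub_lt_one pb hgen hP hy0
  have ha' : algebraMap F L a ≠ 0 := by simpa using ha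
  have h1 := valuation_div_eq_one hd hd0 (h W hW)
  rw [map_div₀, div_eq_one_iff_eq (W.valuation.ne_zero_iff.2 ha'), heq] at h1
  have har : a ∈ P.ring := by
    rw [← hW, ValuationSubring.mem_comap, ← W.valuation_le_one_iff, ← h1]
  obtain ⟨c, hc, hac⟩ := P.exists_sub_mem_maximalIdeal hP har
  refine ⟨algebraMap F L c * d, mul_mem (algebraMap_mem_constants_iff.2 hc) hd, ?_⟩
  have heq2 : y - algebraMap F L c * d =
      algebraMap F L a * (y / algebraMap F L a - d) + algebraMap F L (a - c) * d := by
    rw [map_sub]; field_simp; ring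
  rw [heq2]
  refine W.valuation.map_add_lt ?_ ?_
  · rw [map_mul, ← h1, one_mul]
    exact h W hW
  · rw [map_mul, valuation_eq_one_of_mem_constants W hd hd0, mul_one]
    exact valuation_algebraMap_lt_one hW hac

/-- A prime of degree one extends uniquely to an extension generated by a constant, again as a
prime of degree one. -/
theorem exists_place_of_powerBasis (hF : IsGlobalFunctionField ℓ F) (pb : PowerBasis F L)
    (hgen : pb.gen ∈ constants ℓ L) {P : Place F} (hP : P.degree ℓ = 1) :
    ∃ Q : Place L, Q.degree ℓ = 1 ∧ ∀ x ∈ integers P, algebraMap F L x ∈ integers Q := by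
  have := pb.finite
  have hL : IsGlobalFunctionField ℓ L := hF.of_finiteDimensional
  obtain ⟨W, hWtop, hW⟩ := exists_valuationSubring_comap_eq (L := L) P
  let Q := hL.place hWtop
  refine ⟨Q, ?_, fun x hx => mem_integers_iff.2 fun v hv => ?_⟩
  · refine (finrank_eq_one_iff_of_nonzero' (1 : IsLocalRing.ResidueField Q.ring) one_ne_zero).2
      fun r => ?_
    obtain ⟨⟨y, hy⟩, rfl⟩ := IsLocalRing.residue_surjective r
    obtain ⟨c, hc, hyc⟩ := exists_constant_valuation_sub_lt_one pb hgen hP hW hy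
    refine ⟨⟨c, hc⟩, ?_⟩
    rw [Algebra.smul_def, mul_one, eq_comm, ← sub_eq_zero]
    change IsLocalRing.residue Q.ring ⟨y, hy⟩ - IsLocalRing.residue Q.ring
      (algebraMap (constants ℓ L) Q.ring ⟨c, hc⟩) = 0
    rw [← map_sub, IsLocalRing.residue_eq_zero_iff]
    exact (Q.ring.valuation_lt_one_iff _).2 hyc
  -- A prime of `L` other than `Q` restricts to a prime of `F` other than `P`, by uniqueness of the
  -- extension, and `x` has no pole there.
  · let w : Place F := hF.place (comap_ne_top v.ring_ne_top)
    by_cases hw : w = P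
    · refine absurd (Place.ext_ring (valuationSubring_unique pb hgen hP ?_ hW)) hv
      exact congrArg Place.ring hw
    · exact mem_integers_iff.1 hx w hw

/-- The extension is generated by a root of unity, which is algebraic over `𝔽_ℓ` and therefore
constant. -/
theorem exists_place_cyclotomicField (hF : IsGlobalFunctionField ℓ F) {P : Place F}
    (hP : P.degree ℓ = 1) (n : ℕ) [NeZero (n : F)] :
    IsGlobalFunctionField ℓ (CyclotomicField n F) ∧ ∃ Q : Place (CyclotomicField n F),
      Q.degree ℓ = 1 ∧ ∀ x ∈ integers P, algebraMap F (CyclotomicField n F) x ∈ integers Q := by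
  have : NeZero n := NeZero.of_neZero_natCast F
  have hζ := IsCyclotomicExtension.zeta_spec n F (CyclotomicField n F)
  let pb := hζ.powerBasis F
  have := pb.finite
  refine ⟨hF.of_finiteDimensional, exists_place_of_powerBasis hF pb ?_ hP⟩
  rw [hζ.powerBasis_gen F]
  exact mem_constants_of_pow (NeZero.pos n) (by rw [hζ.pow_eq_one]; exact one_mem _)

end GlobalFF

/-! ### The equation `X ^ p - Y ^ q = 1` -/

namespace GlobalFF

variable {F : Type*} [Field F] {ℓ : ℕ} [Fact ℓ.Prime] [Algebra (ZMod ℓ) F]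

/-- If `Z ^ m - a` is a `q`-th power, where `a ≠ 0` has two distinct `m`-th roots in `F(μ_n)` and
`q` does not divide the class number of `F(μ_n)`, then `Z` is constant. -/
theorem mem_constants_of_cyclotomicField (hF : IsGlobalFunctionField ℓ F) {P : Place F}
    (hP : P.degree ℓ = 1) {n m q : ℕ} (hn : (n : F) ≠ 0) (hm : (m : F) ≠ 0) (hq : q.Prime)
    (hqℓ : q ≠ ℓ) (hcl : ¬ q ∣ classNumber ℓ (CyclotomicField n F)) {a : F}
    (ha : a ∈ constants ℓ F) (ha0 : a ≠ 0) {c₁ c₂ : CyclotomicField n F}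
    (hc₁ : c₁ ^ m = algebraMap F _ a) (hc₂ : c₂ ^ m = algebraMap F _ a) (hc : c₁ ≠ c₂)
    {Z W : F} (hZ : Z ∈ integers P) (h : Z ^ m - a = W ^ q) : Z ∈ constants ℓ F := by
  have : NeZero (n : F) := ⟨hn⟩
  obtain ⟨hL, Q, hQ, hPQ⟩ := exists_place_cyclotomicField hF hP n
  refine algebraMap_mem_constants_iff.1 (hL.mem_constants_of_pow_sub_eq_pow hQ hq hqℓ hcl ?_
    (hPQ Z hZ) hc₁ hc₂ hc (algebraMap_mem_constants_iff.2 ha) ?_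
    (W := algebraMap F (CyclotomicField n F) W) ?_)
  · rwa [← map_natCast (algebraMap F (CyclotomicField n F)), ne_eq, map_eq_zero]
  · rwa [ne_eq, map_eq_zero]
  · rw [← map_pow, ← map_sub, h, map_pow]

theorem exists_primitiveRoot_cyclotomicField {n : ℕ} (hn : (n : F) ≠ 0) :
    ∃ ζ : CyclotomicField n F, IsPrimitiveRoot ζ n := by
  have : NeZero (n : F) := ⟨hn⟩
  have : NeZero n := NeZero.of_neZero_natCast F
  exact ⟨_, IsCyclotomicExtension.zeta_spec n F (CyclotomicField n F)⟩

theorem mem_constants_of_admissible (hF : IsGlobalFunctionField ℓ F) {P : Place F}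
    (hP : P.degree ℓ = 1) {p q : ℕ} (h : Admissible ℓ F p q) {X Y : F} (hX : X ∈ integers P)
    (hY : Y ∈ integers P) (hXY : X ^ p - Y ^ q = 1) :
    X ∈ constants ℓ F ∧ Y ∈ constants ℓ F := by
  obtain ⟨hp, hq, hpℓ, hqℓ, hcl, htwo⟩ := h
  have hpF : (p : F) ≠ 0 := natCast_ne_zero_of_prime_ne hp hpℓ
  have hqF : (q : F) ≠ 0 := natCast_ne_zero_of_prime_ne hq hqℓ
  have hone := one_mem (constants ℓ F)
  have of_left : X ∈ constants ℓ F → X ∈ constants ℓ F ∧ Y ∈ constants ℓ F := fun hx =>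
    ⟨hx, mem_constants_of_pow hq.pos
      (by rw [show Y ^ q = X ^ p - 1 by rw [← hXY]; ring]; exact sub_mem (pow_mem hx _) hone)⟩
  have of_right : Y ∈ constants ℓ F → X ∈ constants ℓ F ∧ Y ∈ constants ℓ F := fun hy =>
    ⟨mem_constants_of_pow hp.pos
      (by rw [show X ^ p = 1 + Y ^ q by rw [← hXY]; ring]; exact add_mem hone (pow_mem hy _)), hy⟩
  -- For equal exponents the equation is a constant difference of `p`-th powers, and no class number
  -- enters.
  by_cases hpq : p = q
  · subst hpq
    exact hF.mem_constants_of_pow_sub_pow hp.one_lt hpF hX hY (by rw [hXY]; exact one_ne_zero)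
      (by rw [hXY]; exact hone)
  have hYX : Y ^ q - (-1) = X ^ p := by rw [← hXY]; ring
  by_cases hqh : q ∣ classNumber ℓ (CyclotomicField p F)
  · apply of_right
    have hneg : (-1 : F) ∈ constants ℓ F := neg_mem hone
    have hneg0 : (-1 : F) ≠ 0 := neg_ne_zero.2 one_ne_zero
    -- For `q = 2` the roots of `Y ^ 2 = -1` are primitive fourth roots of unity, which `F(μ_2) = F`
    -- may lack; hence the condition on `F(μ_4)`.
    by_cases hq2 : q = 2
    · subst hq2
      have h4 : ((4 : ℕ) : F) ≠ 0 := by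
        rw [show ((4 : ℕ) : F) = ((2 : ℕ) : F) * ((2 : ℕ) : F) by push_cast; norm_num]
        exact mul_ne_zero hqF hqF
      obtain ⟨ζ, hζ⟩ := exists_primitiveRoot_cyclotomicField h4
      have hζ2 : ζ ^ 2 = -1 :=
        (hζ.pow (by norm_num) (show 4 = 2 * 2 by norm_num)).eq_neg_one_of_two_right
      have hζ0 : ζ ≠ 0 := hζ.ne_zero (by norm_num)
      refine mem_constants_of_cyclotomicField hF hP h4 hqF hp hpℓ (htwo rfl hpq hqh) hneg hneg0
        (c₁ := ζ) (c₂ := -ζ) (by simp [hζ2]) (by simp [hζ2]) (fun hz => hζ0 ?_) hY hYX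
      have h2 : ((2 : ℕ) : CyclotomicField 4 F) ≠ 0 := by
        rwa [← map_natCast (algebraMap F (CyclotomicField 4 F)), ne_eq, map_eq_zero]
      have : ((2 : ℕ) : CyclotomicField 4 F) * ζ = 0 := by
        push_cast
        linear_combination hz
      exact (mul_eq_zero.1 this).resolve_left h2
    -- For odd `q` both `-1` and `-ζ` are `q`-th roots of `-1` in `F(μ_q)`.
    · have hodd := hq.odd_of_ne_two hq2
      obtain ⟨ζ, hζ⟩ := exists_primitiveRoot_cyclotomicField hqF
      refine mem_constants_of_cyclotomicField hF hP hqF hqF hp hpℓ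
        ((hcl hpq).resolve_left (not_not.2 hqh)) hneg hneg0 (c₁ := -1) (c₂ := -ζ)
        (by simp [hodd.neg_one_pow]) (by simp [hodd.neg_pow, hζ.pow_eq_one]) (fun hz => ?_) hY hYX
      exact hζ.ne_one hq.one_lt (neg_injective hz.symm)
  · apply of_left
    obtain ⟨ζ, hζ⟩ := exists_primitiveRoot_cyclotomicField hpF
    refine mem_constants_of_cyclotomicField hF hP hpF hpF hq hqℓ hqh hone one_ne_zero (c₁ := 1)
      (c₂ := ζ) (by simp) (by simp [hζ.pow_eq_one]) (hζ.ne_one hp.one_lt).symm hX (W := Y) ?_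
    rw [← hXY]; ring

end GlobalFF

theorem theorem1 (ℓ : ℕ) [Fact ℓ.Prime] (F : Type*) [Field F] [Algebra (ZMod ℓ) F]
    (hF : GlobalFF.IsGlobalFunctionField ℓ F)
    (Pinf : GlobalFF.Place F) (hPinf : Pinf.degree ℓ = 1) :
    (∀ p q : ℕ, GlobalFF.Admissible ℓ F p q →
      ∀ X ∈ GlobalFF.integers Pinf, ∀ Y ∈ GlobalFF.integers Pinf,
        X ^ p - Y ^ q = 1 → X ∈ GlobalFF.constants ℓ F ∧ Y ∈ GlobalFF.constants ℓ F) ∧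
    (∀ m n : ℕ, 1 < m → 1 < n →
      (∃ p q : ℕ, p ∣ m ∧ q ∣ n ∧ GlobalFF.Admissible ℓ F p q) →
      ∀ X ∈ GlobalFF.integers Pinf, ∀ Y ∈ GlobalFF.integers Pinf,
        X ^ m - Y ^ n = 1 → X ∈ GlobalFF.constants ℓ F ∧ Y ∈ GlobalFF.constants ℓ F) := by
  refine ⟨fun p q h X hX Y hY hXY => GlobalFF.mem_constants_of_admissible hF hPinf h hX hY hXY, ?_⟩
  rintro m n hm hn ⟨p, q, ⟨r, rfl⟩, ⟨s, rfl⟩, h⟩ X hX Y hY hXY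
  have hr : 0 < r := Nat.pos_of_ne_zero fun h0 => by simp [h0] at hm
  have hs : 0 < s := Nat.pos_of_ne_zero fun h0 => by simp [h0] at hn
  obtain ⟨h1, h2⟩ := GlobalFF.mem_constants_of_admissible hF hPinf h (pow_mem hX r) (pow_mem hY s)
    (by rw [← pow_mul, ← pow_mul, mul_comm r, mul_comm s]; exact hXY)
  exact ⟨GlobalFF.mem_constants_of_pow hr h1, GlobalFF.mem_constants_of_pow hs h2⟩
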